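/- Let $\mathbb K$ be $\mathbb R$ or $\mathbb C$, let $A$ be a (not necessarily unital) Banach algebra over $\mathbb K$ with a bounded approximate left identity, $G$ a locally compact Hausdorff group with a fixed left Haar measure $ds$, and $\alpha$ a strongly continuous action of $G$ on $A$ by bounded automorphisms. The space $C_c(G,A)$ carries the twisted convolution $[f*g](s)=\int_G f(r)\,\alpha_r(g(r^{-1}s))\,dr$. A continuous covariant representation of $(A,G,\alpha)$ in a Banach space $X$ is a pair $(\pi,U)$ of a bounded algebra homomorphism $\pi:A\to B(X)$ and a strongly continuous homomorphism $U$ from $G$ to the invertible operators on $X$, with $\pi(\alpha_s(a))=U_s\pi(a)U_s^{-1}$ for all $a\in A$, $s\in G$. It is non-degenerate if $\mathrm{span}\,\pi(A)X$ is dense in $X$. Its integrated form is $\pi\rtimes U(f)=\int_G\pi(f(s))U_s\,ds$ for $f\in C_c(G,A)$. Let $\mathcal R$ be a non-empty class of non-degenerate continuous covariant representations that is uniformly bounded: there are $C\ge 0$ and a function $\nu:G\to[0,\infty)$, bounded on compact sets, with $\|\pi\|\le C$ and $\|U_r\|\le\nu(r)$ for all $(\pi,U)\in\mathcal R$ and $r\in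 G$. Put $\sigma^{\mathcal R}(f)=\sup_{(\pi,U)\in\mathcal R}\|\pi\rtimes U(f)\|$ and $\nu^{\mathcal R}(r)=\sup_{(\pi,U)\in\mathcal R}\|U_r\|$. Let $(A\rtimes_\alpha G)^{\mathcal R}$ be the Banach algebra obtained by completing $C_c(G,A)/\ker\sigma^{\mathcal R}$ in the norm induced by $\sigma^{\mathcal R}$, and let $q^{\mathcal R}$ be the canonical map from $C_c(G,A)$ into it. A continuous covariant representation $(\pi,U)$ in $X$ is $\mathcal R$-continuous if $\|\pi\rtimes U(f)\|\le C'\sigma^{\mathcal R}(f)$ for all $f$ and some constant $C'$; then $(\pi\rtimes U)^{\mathcal R}$ denotes the unique bounded representation of $(A\rtimes_\alpha G)^{\mathcal R}$ in $X$ with $(\pi\rtimes U)^{\mathcal R}(q^{\mathcal R}(f))=\pi\rtimes U(f)$ for all $f$. Assume that there are constants $D,C_1\ge 0$ such that $\nu^{\mathcal R}(r)\le D$ for all $r\in G$, and $\|f\|_{L^1(G,A)}\le C_1\sigma^{\mathcal R}(f)$ for all $f\in C_c(G,A)$. Let $\mathcal X$ be a class of Banach spaces over $\mathbb K$. (i)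 Every non-degenerate continuous covariant representation $(\pi,U)$ of $(A,G,\alpha)$ in a space from $\mathcal X$ for which there is a constant $C_U$ with $\|U_r\|\le C_U$ for all $r\in G$ is $\mathcal R$-continuous, and the map $(\pi,U)\mapsto(\pi\rtimes U)^{\mathcal R}$ is a bijection from the class of these covariant representations onto the class of all non-degenerate bounded representations of $(A\rtimes_\alpha G)^{\mathcal R}$ in spaces from $\mathcal X$. (ii) This map preserves the set of closed invariant subspaces of an element of its domain, and the space of bounded intertwining operators between two elements of its domain. (iii) The Banach algebra $(A\rtimes_\alpha G)^{\mathcal R}$ is isomorphic (as a topological algebra) to $L^1(G,A)$ with twisted convolution, by an isomorphism that sends the class of $f\in C_c(G,A)$ to $q^{\mathcal R}(f)$. (iv) Suppose that $A$ has a bounded involution, that every $\alpha_s$ preserves it, and that every $(\pi,U)\in\mathcal R$ is involutive, i.e. its space is a Hilbert space, $\pi(a^*)=\pi(a)^*$ for all $a\in A$, and all $U_s$ are unitary. Let $\Delta$ be the modular function, so that $\Delta(r)\int_G f(sr)\,ds=\int_G f(s)\,ds$, and put $f^*(s)=\Delta(s^{-1})\,\alpha_s(f(s^{-1})^*)$ for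 $f\in C_c(G,A)$. Then $(A\rtimes_\alpha G)^{\mathcal R}$ has an involution with $q^{\mathcal R}(f)^*=q^{\mathcal R}(f^*)$ that satisfies the $C^*$-identity, and a covariant representation $(\pi,U)$ in the domain of the bijection is involutive if and only if $(\pi\rtimes U)^{\mathcal R}$ is a $*$-representation in a Hilbert space. -/

import Mathlib

open MeasureTheory Filter Topology
open scoped CompactlySupported NNReal

namespace CrossedProd

noncomputable section


universe u v w

/-! ## Banach spaces as objects -/

/-- A Banach space over `𝕜`, as an object, so that one can speak about classes of Banach spaces. -/
structure BanachSpace (𝕜 : Type u) [RCLike 𝕜] : Type (max u (v + 1)) where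
  carrier : Type v
  normedAddCommGroup : NormedAddCommGroup carrier
  normedSpace : NormedSpace 𝕜 carrier
  completeSpace : CompleteSpace carrier

instance (𝕜 : Type u) [RCLike 𝕜] : CoeSort (BanachSpace.{u, v} 𝕜) (Type v) :=
  ⟨BanachSpace.carrier⟩

attribute [instance] BanachSpace.normedAddCommGroup BanachSpace.normedSpace
  BanachSpace.completeSpace

/-- The underlying real Banach space, used for Bochner integrals. -/
instance (𝕜 : Type u) [RCLike 𝕜] (X : BanachSpace.{u, v} 𝕜) : NormedSpace ℝ X :=
  NormedSpace.restrictScalars ℝ 𝕜 X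

instance (𝕜 : Type u) [RCLike 𝕜] (X : BanachSpace.{u, v} 𝕜) : IsScalarTower ℝ 𝕜 X :=
  IsScalarTower.restrictScalars ℝ 𝕜 X

/-! ## Banach algebra dynamical systems -/

/-- The system `(A, G, α)`: a strongly continuous action `α` of the group `G` on the normed algebra
`A` by bounded automorphisms. (`α s` has the bounded inverse `α s⁻¹`.) -/
structure DynSystem (𝕜 : Type*) [RCLike 𝕜] (A : Type*) [NonUnitalNormedRing A] [NormedSpace 𝕜 A]
    (G : Type*) [Group G] [TopologicalSpace G] where
  act : G →* (A →L[𝕜] A)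
  act_mul : ∀ s a b, act s (a * b) = act s a * act s b
  continuous_act : ∀ a, Continuous fun s => act s a

/-- `A` has a bounded approximate left identity: a net, here presented by the filter of its tails,
that is bounded and satisfies `u_i a → a` for all `a`. -/
def HasBoundedApproxLeftIdentity (A : Type*) [NonUnitalNormedRing A] : Prop :=
  ∃ l : Filter A, l.NeBot ∧ (∃ M : ℝ, ∀ᶠ x in l, ‖x‖ ≤ M) ∧
    ∀ a : A, Tendsto (fun x => x * a) l (𝓝 a)

/-- A family of operators is non-degenerate if the linear span of all `τ b x` is dense. -/
def NonDegenerate {𝕜 : Type*} [RCLike 𝕜] {B X : Type*} [NormedAddCommGroup X] [NormedSpace 𝕜 X]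
    (τ : B → X →L[𝕜] X) : Prop :=
  Dense (Submodule.span 𝕜 {y : X | ∃ b x, y = τ b x} : Set X)

/-! ## Strongly continuous group representations -/

section StronglyContinuous

variable {𝕜 : Type*} [RCLike 𝕜] {G : Type*} [Group G] [TopologicalSpace G]
  {X : Type*} [NormedAddCommGroup X] [NormedSpace 𝕜 X] [CompleteSpace X]

theorem exists_bound_of_isCompact (V : G →* (X →L[𝕜] X)) (hV : ∀ x, Continuous fun s => V s x)
    {K : Set G} (hK : IsCompact K) : ∃ C : ℝ, 0 ≤ C ∧ ∀ s ∈ K, ‖V s‖ ≤ C := by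
  obtain ⟨C, hC⟩ := banach_steinhaus (g := fun s : K => V s) (fun x => by
    obtain ⟨C, hC⟩ := hK.exists_bound_of_continuousOn (hV x).continuousOn
    exact ⟨C, fun s => hC s s.2⟩)
  exact ⟨max C 0, le_max_right _ _, fun s hs => (hC ⟨s, hs⟩).trans (le_max_left _ _)⟩

theorem continuous_uncurry_of_strong [LocallyCompactSpace G] (V : G →* (X →L[𝕜] X))
    (hV : ∀ x, Continuous fun s => V s x) : Continuous fun p : G × X => V p.1 p.2 := by
  rw [continuous_iff_continuousAt]
  rintro ⟨r, x⟩
  obtain ⟨K, hK, hr⟩ := exists_compact_mem_nhds r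
  obtain ⟨C, -, hC⟩ := exists_bound_of_isCompact V hV hK
  have h1 : Tendsto (fun p : G × X => V p.1 (p.2 - x)) (𝓝 (r, x)) (𝓝 0) := by
    have hlim : Tendsto (fun p : G × X => C * ‖p.2 - x‖) (𝓝 (r, x)) (𝓝 0) := by
      have : Continuous fun p : G × X => C * ‖p.2 - x‖ := by fun_prop
      simpa using this.tendsto (r, x)
    refine squeeze_zero_norm' ?_ hlim
    have : ∀ᶠ p : G × X in 𝓝 (r, x), p.1 ∈ K := continuous_fst.continuousAt.eventually_mem hr
    filter_upwards [this] with p hp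
    exact ((V p.1).le_opNorm _).trans (by gcongr; exact hC _ hp)
  have h2 : Tendsto (fun p : G × X => V p.1 x) (𝓝 (r, x)) (𝓝 (V r x)) :=
    ((hV x).comp continuous_fst).tendsto (r, x)
  have := h1.add h2
  simpa [ContinuousAt] using this

end StronglyContinuous

section Main

variable {𝕜 : Type u} [RCLike 𝕜]
  {A : Type*} [NonUnitalNormedRing A] [NormedSpace 𝕜 A] [NormedSpace ℝ A] [IsScalarTower ℝ 𝕜 A]
  [IsScalarTower 𝕜 A A] [SMulCommClass 𝕜 A A] [CompleteSpace A]
  {G : Type*} [Group G] [TopologicalSpace G] [IsTopologicalGroup G] [LocallyCompactSpace G]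
  [T2Space G] [MeasurableSpace G] [BorelSpace G]

/-! ## Twisted convolution on `C_c(G, A)` -/

section Convolution

variable (S : DynSystem 𝕜 A G)

theorem DynSystem.continuous_uncurry : Continuous fun p : G × A => S.act p.1 p.2 :=
  continuous_uncurry_of_strong S.act S.continuous_act

theorem DynSystem.continuous_comp {Z : Type*} [TopologicalSpace Z] {p : Z → G} {q : Z → A}
    (hp : Continuous p) (hq : Continuous q) : Continuous fun z => S.act (p z) (q z) :=
  S.continuous_uncurry.comp (hp.prodMk hq)

theorem eq_zero_of_notMem_tsupport (f : C_c(G, A)) {s : G} (hs : s ∉ tsupport f) : f s = 0 :=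
  image_eq_zero_of_notMem_tsupport hs

/-- The integrand of the twisted convolution. -/
def convKernel (f g : G → A) (s r : G) : A := f r * S.act r (g (r⁻¹ * s))

theorem continuous_convKernel (f g : C_c(G, A)) :
    Continuous (Function.uncurry (convKernel S f g)) := by
  have := S.continuous_comp (Z := G × G) (p := fun z => z.2) (q := fun z => g (z.2⁻¹ * z.1))
    (by fun_prop) (by fun_prop)
  unfold convKernel Function.uncurry
  fun_prop

theorem hasCompactSupport_convKernel (f g : C_c(G, A)) (s : G) :
    HasCompactSupport (convKernel S f g s) :=
  HasCompactSupport.intro f.hasCompactSupport fun r hr => by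
    simp [convKernel, eq_zero_of_notMem_tsupport f hr]

theorem integrable_convKernel (μ : Measure G) [μ.IsHaarMeasure] (f g : C_c(G, A)) (s : G) :
    Integrable (convKernel S f g s) μ :=
  ((continuous_convKernel S f g).comp (by fun_prop : Continuous fun r => (s, r))
    ).integrable_of_hasCompactSupport (hasCompactSupport_convKernel S f g s)

/-- The twisted convolution `[f * g](s) = ∫ f(r) α_r(g(r⁻¹s)) dr`, for functions `G → A`. -/
def twistedConvFun (μ : Measure G) (f g : G → A) (s : G) : A := ∫ r, f r * S.act r (g (r⁻¹ * s)) ∂μ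

/-- The twisted convolution on `C_c(G, A)`. -/
def twistedConv (μ : Measure G) [μ.IsHaarMeasure] (f g : C_c(G, A)) : C_c(G, A) where
  toFun := twistedConvFun S μ f g
  continuous_toFun := by
    rw [← continuousOn_univ]
    exact continuousOn_integral_of_compact_support (f := convKernel S f g) f.hasCompactSupport
      (continuous_convKernel S f g).continuousOn
      fun s r _ hr => by simp [convKernel, eq_zero_of_notMem_tsupport f hr]
  hasCompactSupport' :=
    HasCompactSupport.intro (f.hasCompactSupport.isCompact.mul g.hasCompactSupport.isCompact)
      fun s hs => by
        have : ∀ r, f r * S.act r (g (r⁻¹ * s)) = 0 := fun r => by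
          by_cases hr : r ∈ tsupport f
          · have : r⁻¹ * s ∉ tsupport g := fun h =>
              hs (Set.mem_mul.2 ⟨r, hr, r⁻¹ * s, h, by group⟩)
            simp [eq_zero_of_notMem_tsupport g this]
          · simp [eq_zero_of_notMem_tsupport f hr]
        simp [twistedConvFun, this]

theorem twistedConv_apply (μ : Measure G) [μ.IsHaarMeasure] (f g : C_c(G, A)) (s : G) :
    twistedConv S μ f g s = ∫ r, convKernel S f g s r ∂μ := rfl

theorem twistedConv_assoc (μ : Measure G) [μ.IsHaarMeasure] (f g h : C_c(G, A)) :
    twistedConv S μ (twistedConv S μ f g) h = twistedConv S μ f (twistedConv S μ g h) := by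
  ext s
  let F : G → G → A := fun r t => f t * S.act t (g (t⁻¹ * r)) * S.act r (h (r⁻¹ * s))
  have hFc : Continuous F.uncurry := by
    have h1 := (continuous_convKernel S f g)
    have h2 := S.continuous_comp (Z := G × G) (p := fun z => z.1) (q := fun z => h (z.1⁻¹ * s))
      (by fun_prop) (by fun_prop)
    exact h1.mul h2
  have hFs : HasCompactSupport F.uncurry := by
    refine HasCompactSupport.intro
      ((f.hasCompactSupport.isCompact.mul g.hasCompactSupport.isCompact).prod
        f.hasCompactSupport.isCompact) ?_
    rintro ⟨r, t⟩ hrt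
    by_cases ht : t ∈ tsupport f
    · have : t⁻¹ * r ∉ tsupport g := fun hh =>
        hrt ⟨Set.mem_mul.2 ⟨t, ht, t⁻¹ * r, hh, by group⟩, ht⟩
      simp [F, Function.uncurry, eq_zero_of_notMem_tsupport g this]
    · simp [F, Function.uncurry, eq_zero_of_notMem_tsupport f ht]
  calc twistedConv S μ (twistedConv S μ f g) h s
      = ∫ r, ∫ t, F r t ∂μ ∂μ := by
        rw [twistedConv_apply]
        refine integral_congr_ae (.of_forall fun r => ?_)
        exact (ContinuousLinearMap.integral_comp_comm
          ((ContinuousLinearMap.mul 𝕜 A).flip (S.act r (h (r⁻¹ * s))))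
          (integrable_convKernel S μ f g r)).symm
    _ = ∫ t, ∫ r, F r t ∂μ ∂μ := integral_integral_swap_of_hasCompactSupport hFc hFs
    _ = ∫ t, ∫ r, F (t * r) t ∂μ ∂μ := by
        refine integral_congr_ae (.of_forall fun t => ?_)
        exact (integral_mul_left_eq_self (fun r => F r t) t).symm
    _ = ∫ t, f t * S.act t (∫ r, convKernel S g h (t⁻¹ * s) r ∂μ) ∂μ := by
        refine integral_congr_ae (.of_forall fun t => ?_)
        have hi := integrable_convKernel S μ g h (t⁻¹ * s)
        have := ContinuousLinearMap.integral_comp_comm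
          ((ContinuousLinearMap.mul 𝕜 A (f t)).comp (S.act t)) hi
        simp only [ContinuousLinearMap.comp_apply, ContinuousLinearMap.mul_apply'] at this
        simp only
        rw [← this]
        refine integral_congr_ae (.of_forall fun r => ?_)
        simp [F, convKernel, S.act_mul, mul_assoc]
    _ = _ := rfl

theorem twistedConv_add_right (μ : Measure G) [μ.IsHaarMeasure] (f g h : C_c(G, A)) :
    twistedConv S μ f (g + h) = twistedConv S μ f g + twistedConv S μ f h := by
  ext s
  rw [CompactlySupportedContinuousMap.add_apply, twistedConv_apply, twistedConv_apply,
    twistedConv_apply, ← integral_add (integrable_convKernel S μ f g s)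
    (integrable_convKernel S μ f h s)]
  simp [convKernel, mul_add]

theorem twistedConv_add_left (μ : Measure G) [μ.IsHaarMeasure] (f g h : C_c(G, A)) :
    twistedConv S μ (f + g) h = twistedConv S μ f h + twistedConv S μ g h := by
  ext s
  rw [CompactlySupportedContinuousMap.add_apply, twistedConv_apply, twistedConv_apply,
    twistedConv_apply, ← integral_add (integrable_convKernel S μ f h s)
    (integrable_convKernel S μ g h s)]
  simp [convKernel, add_mul]

theorem twistedConv_smul_right (μ : Measure G) [μ.IsHaarMeasure] (c : 𝕜) (f g : C_c(G, A)) :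
    twistedConv S μ f (c • g) = c • twistedConv S μ f g := by
  ext s
  rw [CompactlySupportedContinuousMap.smul_apply, twistedConv_apply, twistedConv_apply,
    ← integral_smul]
  simp [convKernel, mul_smul_comm]

theorem twistedConv_smul_left (μ : Measure G) [μ.IsHaarMeasure] (c : 𝕜) (f g : C_c(G, A)) :
    twistedConv S μ (c • f) g = c • twistedConv S μ f g := by
  ext s
  rw [CompactlySupportedContinuousMap.smul_apply, twistedConv_apply, twistedConv_apply,
    ← integral_smul]
  simp [convKernel, smul_mul_assoc]

theorem twistedConv_zero_left (μ : Measure G) [μ.IsHaarMeasure] (f : C_c(G, A)) :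
    twistedConv S μ 0 f = 0 := by
  ext s; simp [twistedConv_apply, convKernel]

theorem twistedConv_zero_right (μ : Measure G) [μ.IsHaarMeasure] (f : C_c(G, A)) :
    twistedConv S μ f 0 = 0 := by
  ext s; simp [twistedConv_apply, convKernel]

end Convolution

/-! ## The modular function and the involution on `C_c(G, A)` -/

section Involution

/-- The modular function `Δ` of `G`, normalized by `Δ(r) ∫ f(sr) ds = ∫ f(s) ds`. -/
def modularFun (r : G) : ℝ := ((Measure.modularCharacter r : ℝ≥0) : ℝ)⁻¹

theorem modularCharacter_mul_integral (μ : Measure G) [μ.IsHaarMeasure] {f : G → ℝ}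
    (hf : Continuous f) (hs : HasCompactSupport f) (r : G) :
    ((Measure.modularCharacter r : ℝ≥0) : ℝ) * ∫ s, f s ∂μ = ∫ s, f (s * r) ∂μ := by
  have h := Measure.integral_isMulLeftInvariant_eq_smul_of_hasCompactSupport
    (μ.map (· * r)) μ hf hs
  have h2 : (Measure.modularCharacter r : ℝ≥0) = Measure.haarScalarFactor (μ.map (· * r)) μ :=
    Measure.modularCharacterFun_eq_haarScalarFactor μ r
  rw [integral_map (by fun_prop) hf.aestronglyMeasurable] at h
  rw [h, h2, integral_smul_nnreal_measure]
  rfl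

theorem modularFun_mul_integral (μ : Measure G) [μ.IsHaarMeasure] {f : G → ℝ}
    (hf : Continuous f) (hs : HasCompactSupport f) (r : G) :
    modularFun r * ∫ s, f (s * r) ∂μ = ∫ s, f s ∂μ := by
  have hpos : (0 : ℝ) < (Measure.modularCharacter r : ℝ≥0) :=
    NNReal.coe_pos.2 (Measure.modularCharacterFun_pos r)
  rw [← modularCharacter_mul_integral μ hf hs, modularFun, inv_mul_cancel_left₀ hpos.ne']

theorem continuous_modularFun : Continuous (modularFun : G → ℝ) := by
  obtain ⟨⟨f, hf⟩, hs, hn, h1⟩ :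
    ∃ f : C(G, ℝ), HasCompactSupport f ∧ 0 ≤ f ∧ f 1 ≠ 0 := exists_continuous_nonneg_pos 1
  let μ : Measure G := Measure.haar
  have hpos : 0 < ∫ s, f s ∂μ :=
    hf.integral_pos_of_hasCompactSupport_nonneg_nonzero hs hn h1
  have hc : Continuous fun r : G => ∫ s, f (s * r) ∂μ := by
    rw [continuous_iff_continuousAt]
    intro r
    obtain ⟨K, hK, hr⟩ := exists_compact_mem_nhds r
    refine ContinuousOn.continuousAt (s := K) ?_ hr
    refine continuousOn_integral_of_compact_support (f := fun r s => f (s * r))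
      (hs.isCompact.mul hK.inv) (by fun_prop) fun p s hp hsn => ?_
    refine image_eq_zero_of_notMem_tsupport fun h => hsn ?_
    exact Set.mem_mul.2 ⟨s * p, h, p⁻¹, Set.inv_mem_inv.2 hp, by group⟩
  have heq : (modularFun : G → ℝ) = fun r => (∫ s, f s ∂μ) / ∫ s, f (s * r) ∂μ := by
    funext r
    have h2 := modularCharacter_mul_integral μ hf hs r
    have hm : (0 : ℝ) < (Measure.modularCharacter r : ℝ≥0) :=
      NNReal.coe_pos.2 (Measure.modularCharacterFun_pos r)
    rw [← h2, modularFun]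
    field_simp
  rw [heq]
  refine continuous_const.div hc fun r => ?_
  have hm : (0 : ℝ) < (Measure.modularCharacter r : ℝ≥0) :=
    NNReal.coe_pos.2 (Measure.modularCharacterFun_pos r)
  rw [← modularCharacter_mul_integral μ hf hs r]
  positivity

/-- The involution `f*(s) = Δ(s⁻¹) α_s(f(s⁻¹)*)` on `C_c(G, A)`, when `A` has a bounded (that is,
continuous) involution. -/
def starCc [StarRing A] [ContinuousStar A] (S : DynSystem 𝕜 A G) (f : C_c(G, A)) : C_c(G, A) where
  toFun s := modularFun s⁻¹ • S.act s (star (f s⁻¹))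
  continuous_toFun := by
    have h1 : Continuous fun s : G => S.act s (star (f s⁻¹)) :=
      S.continuous_comp continuous_id (by fun_prop)
    exact (continuous_modularFun.comp continuous_inv).smul h1
  hasCompactSupport' :=
    HasCompactSupport.intro f.hasCompactSupport.isCompact.inv fun s hs => by
      have : s⁻¹ ∉ tsupport f := fun h => hs (Set.mem_inv.2 h)
      simp [eq_zero_of_notMem_tsupport f this]

end Involution

/-! ## Continuous covariant representations and their integrated forms -/

/-- A continuous covariant representation `(π, U)` of `(A, G, α)` in the Banach space `X`: `π` is a
bounded representation of `A`, `U` a strongly continuous representation of `G` (by invertible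
operators, since `G` is a group), and `π(α_s(a)) = U_s π(a) U_s⁻¹`. -/
structure CovRep (S : DynSystem 𝕜 A G) (X : BanachSpace.{u, v} 𝕜) where
  π : A →L[𝕜] (X →L[𝕜] X)
  π_mul : ∀ a b, π (a * b) = π a * π b
  U : G →* (X →L[𝕜] X)
  continuous_U : ∀ x, Continuous fun s => U s x
  covariant : ∀ s a, π (S.act s a) = U s * π a * U s⁻¹

namespace CovRep

variable {S : DynSystem 𝕜 A G} {X : BanachSpace.{u, v} 𝕜} (ρ : CovRep S X)

theorem covariant_apply (s : G) (a : A) (x : X) : ρ.π (S.act s a) (ρ.U s x) = ρ.U s (ρ.π a x) := by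
  rw [ρ.covariant]
  have h : ρ.U s⁻¹ * ρ.U s = 1 := by rw [← map_mul, inv_mul_cancel, map_one]
  have hx : ρ.U s⁻¹ (ρ.U s x) = x := congrArg (fun L : X →L[𝕜] X => L x) h
  simp only [mul_apply_eq_comp, hx]

theorem continuous_comp {Z : Type*} [TopologicalSpace Z] {p : Z → G} {q : Z → A} {y : Z → X}
    (hp : Continuous p) (hq : Continuous q) (hy : Continuous y) :
    Continuous fun z => ρ.π (q z) (ρ.U (p z) (y z)) :=
  (ρ.π.continuous.comp hq).clm_apply
    ((continuous_uncurry_of_strong ρ.U ρ.continuous_U).comp (hp.prodMk hy))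

theorem integrable (μ : Measure G) [μ.IsHaarMeasure] (f : C_c(G, A)) (x : X) :
    Integrable (fun s => ρ.π (f s) (ρ.U s x)) μ :=
  (ρ.continuous_comp continuous_id f.continuous continuous_const).integrable_of_hasCompactSupport
    (HasCompactSupport.intro f.hasCompactSupport fun s hs => by
      simp [eq_zero_of_notMem_tsupport f hs])

theorem norm_integral_le (μ : Measure G) [μ.IsHaarMeasure] (f : C_c(G, A)) {C M : ℝ} (hC : 0 ≤ C)
    (hπ : ‖ρ.π‖ ≤ C) (hM : ∀ s ∈ tsupport f, ‖ρ.U s‖ ≤ M) (x : X) :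
    ‖∫ s, ρ.π (f s) (ρ.U s x) ∂μ‖ ≤ C * M * (∫ s, ‖f s‖ ∂μ) * ‖x‖ := by
  have hi : Integrable (fun s => ‖f s‖) μ :=
    (f.continuous.integrable_of_hasCompactSupport f.hasCompactSupport).norm
  calc ‖∫ s, ρ.π (f s) (ρ.U s x) ∂μ‖ ≤ ∫ s, C * M * ‖x‖ * ‖f s‖ ∂μ := by
        refine norm_integral_le_of_norm_le (hi.const_mul _) (.of_forall fun s => ?_)
        by_cases hs : s ∈ tsupport f
        · calc ‖ρ.π (f s) (ρ.U s x)‖ ≤ ‖ρ.π (f s)‖ * ‖ρ.U s x‖ := (ρ.π (f s)).le_opNorm _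
            _ ≤ (C * ‖f s‖) * (M * ‖x‖) := by
              gcongr
              · exact (ρ.π.le_opNorm _).trans (by gcongr)
              · exact ((ρ.U s).le_opNorm _).trans (by gcongr; exact hM s hs)
            _ = _ := by ring
        · simp [eq_zero_of_notMem_tsupport f hs]
    _ = _ := by rw [integral_const_mul]; ring

/-- The integrated form `π ⋊ U (f) = ∫ π(f(s)) U_s ds`, an operator defined pointwise. -/
def integrated (μ : Measure G) [μ.IsHaarMeasure] (f : C_c(G, A)) : X →L[𝕜] X :=
  LinearMap.mkContinuousOfExistsBound
    { toFun := fun x => ∫ s, ρ.π (f s) (ρ.U s x) ∂μ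
      map_add' := fun x y => by
        simp only [map_add]
        exact integral_add (ρ.integrable μ f x) (ρ.integrable μ f y)
      map_smul' := fun c x => by
        simp only [map_smul]
        exact integral_smul c _ }
    (by
      obtain ⟨M, -, hM⟩ :=
        exists_bound_of_isCompact ρ.U ρ.continuous_U f.hasCompactSupport.isCompact
      exact ⟨_, ρ.norm_integral_le μ f (norm_nonneg ρ.π) le_rfl hM⟩)

theorem integrated_apply (μ : Measure G) [μ.IsHaarMeasure] (f : C_c(G, A)) (x : X) :
    ρ.integrated μ f x = ∫ s, ρ.π (f s) (ρ.U s x) ∂μ := rfl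

theorem integrated_add (μ : Measure G) [μ.IsHaarMeasure] (f g : C_c(G, A)) :
    ρ.integrated μ (f + g) = ρ.integrated μ f + ρ.integrated μ g := by
  ext x
  simp only [integrated_apply, add_apply]
  rw [← integral_add (ρ.integrable μ f x) (ρ.integrable μ g x)]
  simp

theorem integrated_smul (μ : Measure G) [μ.IsHaarMeasure] (c : 𝕜) (f : C_c(G, A)) :
    ρ.integrated μ (c • f) = c • ρ.integrated μ f := by
  ext x
  simp only [integrated_apply, smul_apply]
  rw [← integral_smul]
  simp

theorem integrated_conv (μ : Measure G) [μ.IsHaarMeasure] (f g : C_c(G, A)) :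
    ρ.integrated μ (twistedConv S μ f g) = ρ.integrated μ f * ρ.integrated μ g := by
  ext x
  let F : G → G → X := fun s r => ρ.π (convKernel S f g s r) (ρ.U s x)
  have hFc : Continuous F.uncurry :=
    ρ.continuous_comp continuous_fst (continuous_convKernel S f g) continuous_const
  have hFs : HasCompactSupport F.uncurry := by
    refine HasCompactSupport.intro
      ((f.hasCompactSupport.isCompact.mul g.hasCompactSupport.isCompact).prod
        f.hasCompactSupport.isCompact) ?_
    rintro ⟨r, t⟩ hrt
    by_cases ht : t ∈ tsupport f
    · have : t⁻¹ * r ∉ tsupport g := fun hh =>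
        hrt ⟨Set.mem_mul.2 ⟨t, ht, t⁻¹ * r, hh, by group⟩, ht⟩
      simp [F, Function.uncurry, convKernel, eq_zero_of_notMem_tsupport g this]
    · simp [F, Function.uncurry, convKernel, eq_zero_of_notMem_tsupport f ht]
  calc ρ.integrated μ (twistedConv S μ f g) x
      = ∫ s, ∫ r, F s r ∂μ ∂μ := by
        rw [integrated_apply]
        refine integral_congr_ae (.of_forall fun s => ?_)
        exact (ContinuousLinearMap.integral_comp_comm (ρ.π.flip (ρ.U s x))
          (integrable_convKernel S μ f g s)).symm
    _ = ∫ r, ∫ s, F s r ∂μ ∂μ := integral_integral_swap_of_hasCompactSupport hFc hFs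
    _ = ∫ r, ∫ s, F (r * s) r ∂μ ∂μ := by
        refine integral_congr_ae (.of_forall fun r => ?_)
        exact (integral_mul_left_eq_self (fun s => F s r) r).symm
    _ = ∫ r, ρ.π (f r) (ρ.U r (∫ s, ρ.π (g s) (ρ.U s x) ∂μ)) ∂μ := by
        refine integral_congr_ae (.of_forall fun r => ?_)
        have := ContinuousLinearMap.integral_comp_comm ((ρ.π (f r)).comp (ρ.U r))
          (ρ.integrable μ g x)
        simp only [ContinuousLinearMap.comp_apply] at this
        simp only
        rw [← this]
        refine integral_congr_ae (.of_forall fun s => ?_)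
        simp [F, convKernel, ρ.π_mul, ρ.covariant_apply]
    _ = _ := rfl

/-- `(π, U)` is non-degenerate if `π` is. -/
def IsNonDegenerate : Prop := NonDegenerate fun a => ρ.π a

/-- `(π, U)` is involutive: `X` is a Hilbert space (its norm comes from an inner product), `π` is a
`*`-representation and `U` is unitary. -/
def IsInvolutive [Star A] : Prop :=
  ∃ h : InnerProductSpace 𝕜 X, h.toNormedSpace = X.normedSpace ∧
    (∀ a (x y : X), inner 𝕜 (ρ.π a x) y = inner 𝕜 x (ρ.π (star a) y)) ∧
    ∀ s (x y : X), inner 𝕜 (ρ.U s x) (ρ.U s y) = inner 𝕜 x y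

/-- There is a constant `C_U` with `‖U_r‖ ≤ C_U` for all `r`. -/
def IsUniformlyBounded : Prop := ∃ C : ℝ, ∀ r, ‖ρ.U r‖ ≤ C

/-- A subspace is invariant for `(π, U)`. -/
def IsInvariant (Y : Submodule 𝕜 X) : Prop :=
  (∀ a, ∀ y ∈ Y, ρ.π a y ∈ Y) ∧ ∀ s, ∀ y ∈ Y, ρ.U s y ∈ Y

/-- `Φ` intertwines two covariant representations. -/
def Intertwines {X' : BanachSpace.{u, w} 𝕜} (ρ : CovRep S X) (ρ' : CovRep S X')
    (Φ : X →L[𝕜] X') : Prop :=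
  (∀ a, (ρ'.π a).comp Φ = Φ.comp (ρ.π a)) ∧ ∀ s, (ρ'.U s).comp Φ = Φ.comp (ρ.U s)

end CovRep

/-! ## Uniformly bounded classes and the crossed product -/

/-- A non-empty uniformly bounded class `𝓡` of continuous covariant representations. -/
structure UniformlyBoundedClass (S : DynSystem 𝕜 A G) where
  carrier : Set (Σ X : BanachSpace.{u, v} 𝕜, CovRep S X)
  nonempty : carrier.Nonempty
  bounded : ∃ (C : ℝ) (ν : G → ℝ), 0 ≤ C ∧ (∀ r, 0 ≤ ν r) ∧
    (∀ K : Set G, IsCompact K → BddAbove (ν '' K)) ∧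
    ∀ ρ ∈ carrier, ‖ρ.2.π‖ ≤ C ∧ ∀ r, ‖ρ.2.U r‖ ≤ ν r

namespace UniformlyBoundedClass

variable {S : DynSystem 𝕜 A G} (R : UniformlyBoundedClass.{u, v} S)

instance : Nonempty R.carrier := R.nonempty.to_subtype

/-- `ν^𝓡(r) = sup ‖U_r‖` over all `(π, U)` in `𝓡`. -/
def nu (r : G) : ℝ := ⨆ ρ : R.carrier, ‖ρ.1.2.U r‖

/-- `σ^𝓡(f) = sup ‖π ⋊ U (f)‖` over all `(π, U)` in `𝓡`. -/
def sigma (μ : Measure G) [μ.IsHaarMeasure] (f : C_c(G, A)) : ℝ :=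
  ⨆ ρ : R.carrier, ‖ρ.1.2.integrated μ f‖

theorem bddAbove_integrated (μ : Measure G) [μ.IsHaarMeasure] (f : C_c(G, A)) :
    BddAbove (Set.range fun ρ : R.carrier => ‖ρ.1.2.integrated μ f‖) := by
  obtain ⟨C, ν, hC, hν, hK, hb⟩ := R.bounded
  obtain ⟨M, hM⟩ := hK _ f.hasCompactSupport.isCompact
  refine ⟨C * max M 0 * ∫ s, ‖f s‖ ∂μ, ?_⟩
  rintro _ ⟨ρ, rfl⟩
  refine ContinuousLinearMap.opNorm_le_bound _ (by positivity) fun x => ?_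
  exact ρ.1.2.norm_integral_le μ f hC (hb _ ρ.2).1
    (fun s hs => ((hb _ ρ.2).2 s).trans ((hM ⟨s, hs, rfl⟩).trans (le_max_left _ _))) x

theorem norm_integrated_le_sigma (μ : Measure G) [μ.IsHaarMeasure] (f : C_c(G, A))
    (ρ : R.carrier) : ‖ρ.1.2.integrated μ f‖ ≤ R.sigma μ f :=
  le_ciSup (R.bddAbove_integrated μ f) ρ

theorem sigma_nonneg (μ : Measure G) [μ.IsHaarMeasure] (f : C_c(G, A)) : 0 ≤ R.sigma μ f :=
  Real.iSup_nonneg fun _ => norm_nonneg _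

theorem sigma_add_le (μ : Measure G) [μ.IsHaarMeasure] (f g : C_c(G, A)) :
    R.sigma μ (f + g) ≤ R.sigma μ f + R.sigma μ g :=
  ciSup_le fun ρ => by
    rw [CovRep.integrated_add]
    exact (norm_add_le _ _).trans
      (add_le_add (R.norm_integrated_le_sigma μ f ρ) (R.norm_integrated_le_sigma μ g ρ))

theorem sigma_smul (μ : Measure G) [μ.IsHaarMeasure] (c : 𝕜) (f : C_c(G, A)) :
    R.sigma μ (c • f) = ‖c‖ * R.sigma μ f := by
  simp only [sigma, CovRep.integrated_smul, norm_smul]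
  exact (Real.mul_iSup_of_nonneg (norm_nonneg _) _).symm

theorem sigma_neg (μ : Measure G) [μ.IsHaarMeasure] (f : C_c(G, A)) :
    R.sigma μ (-f) = R.sigma μ f := by
  have := R.sigma_smul μ (-1 : 𝕜) f
  rwa [neg_one_smul, norm_neg, norm_one, one_mul] at this

theorem sigma_conv_le (μ : Measure G) [μ.IsHaarMeasure] (f g : C_c(G, A)) :
    R.sigma μ (twistedConv S μ f g) ≤ R.sigma μ f * R.sigma μ g :=
  ciSup_le fun ρ => by
    rw [CovRep.integrated_conv]
    exact (norm_mul_le _ _).trans (mul_le_mul (R.norm_integrated_le_sigma μ f ρ)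
      (R.norm_integrated_le_sigma μ g ρ) (norm_nonneg _) (R.sigma_nonneg μ f))

/-- The algebra `C_c(G, A)`, with twisted convolution as product and `σ^𝓡` as seminorm. -/
def CcAlgebra (_μ : Measure G) (_R : UniformlyBoundedClass.{u, v} S) : Type _ := C_c(G, A)

variable (μ : Measure G) [μ.IsHaarMeasure]

instance : AddCommGroup (CcAlgebra μ R) := inferInstanceAs (AddCommGroup C_c(G, A))

instance : Module 𝕜 (CcAlgebra μ R) := inferInstanceAs (Module 𝕜 C_c(G, A))

/-- A function in `C_c(G, A)`, as an element of the algebra `CcAlgebra μ R`. -/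
def toCc (f : C_c(G, A)) : CcAlgebra μ R := f

/-- The seminorm `σ^𝓡`. -/
def sigmaSeminorm : AddGroupSeminorm (CcAlgebra μ R) where
  toFun f := R.sigma μ f
  map_zero' := by
    have := R.sigma_smul μ (0 : 𝕜) (0 : C_c(G, A))
    rw [zero_smul, norm_zero, zero_mul] at this
    exact this
  add_le' := R.sigma_add_le μ
  neg' f := R.sigma_neg μ f

instance : SeminormedAddCommGroup (CcAlgebra μ R) :=
  (sigmaSeminorm R μ).toSeminormedAddCommGroup

instance : NonUnitalSeminormedRing (CcAlgebra μ R) where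
  __ : SeminormedAddCommGroup (CcAlgebra μ R) := inferInstance
  mul f g := twistedConv S μ f g
  left_distrib := twistedConv_add_right S μ
  right_distrib := twistedConv_add_left S μ
  zero_mul := twistedConv_zero_left S μ
  mul_zero := twistedConv_zero_right S μ
  mul_assoc f g h := twistedConv_assoc S μ f g h
  norm_mul_le f g := R.sigma_conv_le μ f g

instance : NormedSpace 𝕜 (CcAlgebra μ R) where
  norm_smul_le c f := (R.sigma_smul μ c f).le

instance : IsScalarTower 𝕜 (CcAlgebra μ R) (CcAlgebra μ R) where
  smul_assoc := twistedConv_smul_left S μ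

instance : SMulCommClass 𝕜 (CcAlgebra μ R) (CcAlgebra μ R) where
  smul_comm c f g := (twistedConv_smul_right S μ c f g).symm

/-- The crossed product `(A ⋊_α G)^𝓡`: the (Hausdorff) completion of `C_c(G, A)` in the seminorm
`σ^𝓡`, i.e. the completion of `C_c(G, A) / ker σ^𝓡` in the induced norm. -/
def CrossedProduct : Type _ := UniformSpace.Completion (CcAlgebra μ R)

namespace CrossedProduct

instance : NormedAddCommGroup (R.CrossedProduct μ) :=
  inferInstanceAs (NormedAddCommGroup (UniformSpace.Completion (CcAlgebra μ R)))

instance : NormedSpace 𝕜 (R.CrossedProduct μ) :=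
  inferInstanceAs (NormedSpace 𝕜 (UniformSpace.Completion (CcAlgebra μ R)))

instance : CompleteSpace (R.CrossedProduct μ) :=
  inferInstanceAs (CompleteSpace (UniformSpace.Completion (CcAlgebra μ R)))

/-- The canonical map into the completion, as a continuous linear map. -/
def incl : CcAlgebra μ R →L[𝕜] R.CrossedProduct μ :=
  (UniformSpace.Completion.toComplL : CcAlgebra μ R →L[𝕜] UniformSpace.Completion (CcAlgebra μ R))

theorem denseRange_incl : DenseRange (incl R μ) :=
  UniformSpace.Completion.denseRange_coe (α := CcAlgebra μ R)

theorem isUniformInducing_incl : IsUniformInducing (incl R μ) :=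
  UniformSpace.Completion.isUniformInducing_coe (CcAlgebra μ R)

theorem norm_incl (f : CcAlgebra μ R) : ‖incl R μ f‖ = ‖f‖ :=
  UniformSpace.Completion.norm_coe f

/-- The product on the crossed product as a bounded bilinear map, extending that of `C_c(G, A)`. -/
def mulL : R.CrossedProduct μ →L[𝕜] R.CrossedProduct μ →L[𝕜] R.CrossedProduct μ :=
  ContinuousLinearMap.extend
    (ContinuousLinearMap.flip (ContinuousLinearMap.extend
      ((ContinuousLinearMap.compL 𝕜 (CcAlgebra μ R) (CcAlgebra μ R) (R.CrossedProduct μ)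
        (incl R μ)).comp (ContinuousLinearMap.mul 𝕜 (CcAlgebra μ R))).flip (incl R μ)))
    (incl R μ)

instance : Mul (R.CrossedProduct μ) := ⟨fun a b => mulL R μ a b⟩

theorem mul_def (a b : R.CrossedProduct μ) : a * b = mulL R μ a b := rfl

theorem incl_mul (f g : CcAlgebra μ R) : incl R μ (f * g) = incl R μ f * incl R μ g := by
  rw [mul_def, mulL, ContinuousLinearMap.extend_eq _ (denseRange_incl R μ)
    (isUniformInducing_incl R μ), ContinuousLinearMap.flip_apply, ContinuousLinearMap.extend_eq _
    (denseRange_incl R μ) (isUniformInducing_incl R μ)]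
  rfl

theorem continuous_mul : Continuous fun p : R.CrossedProduct μ × R.CrossedProduct μ => p.1 * p.2 :=
  ((mulL R μ).continuous.comp continuous_fst).clm_apply continuous_snd

@[elab_as_elim]
theorem induction {p : R.CrossedProduct μ → Prop} (a : R.CrossedProduct μ)
    (hp : IsClosed {a | p a}) (h : ∀ f, p (incl R μ f)) : p a :=
  (denseRange_incl R μ).induction_on a hp h

instance : NonUnitalNormedRing (R.CrossedProduct μ) where
  __ : NormedAddCommGroup (R.CrossedProduct μ) := inferInstance
  mul a b := mulL R μ a b
  left_distrib a b c := map_add _ _ _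
  right_distrib a b c := by
    change mulL R μ (a + b) c = mulL R μ a c + mulL R μ b c
    rw [map_add, add_apply]
  zero_mul a := by
    change mulL R μ 0 a = 0
    rw [map_zero, zero_apply]
  mul_zero a := map_zero _
  mul_assoc a b c := by
    have hm : ∀ {p q : R.CrossedProduct μ → R.CrossedProduct μ}, Continuous p → Continuous q →
        Continuous fun x => p x * q x := fun hp hq =>
      (continuous_mul R μ).comp (hp.prodMk hq)
    change a * b * c = a * (b * c)
    revert b c
    refine induction R μ a ?_ (fun f => ?_)
    · simp only [Set.ofPred_forall]
      refine isClosed_iInter fun b => isClosed_iInter fun c => ?_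
      exact isClosed_eq (hm (hm continuous_id continuous_const) continuous_const)
        (hm continuous_id continuous_const)
    intro b
    refine induction R μ b ?_ (fun g => ?_)
    · simp only [Set.ofPred_forall]
      refine isClosed_iInter fun c => ?_
      exact isClosed_eq (hm (hm continuous_const continuous_id) continuous_const)
        (hm continuous_const (hm continuous_id continuous_const))
    intro c
    refine induction R μ c ?_ (fun h => ?_)
    · exact isClosed_eq (hm continuous_const continuous_id)
        (hm continuous_const (hm continuous_const continuous_id))
    simp only [← incl_mul, mul_assoc]
  norm_mul_le a b := by
    change ‖a * b‖ ≤ ‖a‖ * ‖b‖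
    revert b
    refine induction R μ a ?_ (fun f => ?_)
    · simp only [Set.ofPred_forall]
      refine isClosed_iInter fun b => isClosed_le ?_ (by fun_prop)
      exact ((continuous_mul R μ).comp (continuous_id.prodMk continuous_const)).norm
    intro b
    refine induction R μ b ?_ (fun g => ?_)
    · refine isClosed_le ?_ (by fun_prop)
      exact ((continuous_mul R μ).comp (continuous_const.prodMk continuous_id)).norm
    rw [← incl_mul, norm_incl, norm_incl, norm_incl]
    exact norm_mul_le f g

instance : IsScalarTower 𝕜 (R.CrossedProduct μ) (R.CrossedProduct μ) where
  smul_assoc c a b := by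
    change mulL R μ (c • a) b = c • mulL R μ a b
    rw [map_smul, smul_apply]

instance : SMulCommClass 𝕜 (R.CrossedProduct μ) (R.CrossedProduct μ) where
  smul_comm c a b := (map_smul (mulL R μ a) c b).symm

end CrossedProduct

/-- The canonical map `q^𝓡 : C_c(G, A) → (A ⋊_α G)^𝓡`. -/
def q (f : C_c(G, A)) : R.CrossedProduct μ := CrossedProduct.incl R μ (toCc R μ f)

theorem q_conv (f g : C_c(G, A)) : R.q μ (twistedConv S μ f g) = R.q μ f * R.q μ g :=
  CrossedProduct.incl_mul R μ (toCc R μ f) (toCc R μ g)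

theorem norm_q (f : C_c(G, A)) : ‖R.q μ f‖ = R.sigma μ f :=
  CrossedProduct.norm_incl R μ (toCc R μ f)

theorem denseRange_q : DenseRange (R.q μ) := CrossedProduct.denseRange_incl R μ

end UniformlyBoundedClass

/-! ## Bounded representations of the crossed product, and integration -/

variable {S : DynSystem 𝕜 A G} (μ : Measure G) [μ.IsHaarMeasure]

/-- A bounded representation `T` of `(A ⋊_α G)^𝓡` in the Banach space `X`. -/
structure CrossedRep (R : UniformlyBoundedClass.{u, v} S) (X : BanachSpace.{u, w} 𝕜) where
  T : R.CrossedProduct μ →L[𝕜] (X →L[𝕜] X)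
  T_mul : ∀ a b, T (a * b) = T a * T b

namespace CrossedRep

variable {μ} {R : UniformlyBoundedClass.{u, v} S} {X : BanachSpace.{u, w} 𝕜}

/-- Non-degeneracy of `T`. -/
def IsNonDegenerate (τ : CrossedRep μ R X) : Prop := NonDegenerate fun c => τ.T c

/-- `T` is involutive, for a given involution on the crossed product: `X` is a Hilbert space and
`T` is a `*`-representation. -/
def IsInvolutive [Star (R.CrossedProduct μ)] (τ : CrossedRep μ R X) : Prop :=
  ∃ h : InnerProductSpace 𝕜 X, h.toNormedSpace = X.normedSpace ∧
    ∀ c (x y : X), inner 𝕜 (τ.T c x) y = inner 𝕜 x (τ.T (star c) y)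

/-- A subspace is invariant for `T`. -/
def IsInvariant (τ : CrossedRep μ R X) (Y : Submodule 𝕜 X) : Prop := ∀ c, ∀ y ∈ Y, τ.T c y ∈ Y

/-- `Φ` intertwines two representations of the crossed product. -/
def Intertwines {X' : BanachSpace.{u, w} 𝕜} (τ : CrossedRep μ R X) (τ' : CrossedRep μ R X')
    (Φ : X →L[𝕜] X') : Prop :=
  ∀ c, (τ'.T c).comp Φ = Φ.comp (τ.T c)

end CrossedRep

/-- `(π, U)` is `𝓡`-continuous: `π ⋊ U` is bounded with respect to `σ^𝓡`. -/
def CovRep.IsRContinuous (R : UniformlyBoundedClass.{u, v} S) {X : BanachSpace.{u, w} 𝕜}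
    (ρ : CovRep S X) : Prop :=
  ∃ C : ℝ, ∀ f : C_c(G, A), ‖ρ.integrated μ f‖ ≤ C * R.sigma μ f

section Integration

variable {μ} {R : UniformlyBoundedClass.{u, v} S} {X : BanachSpace.{u, w} 𝕜}

/-- The integrated form of an `𝓡`-continuous covariant representation, as a bounded map on
`C_c(G, A)` with the seminorm `σ^𝓡`. -/
def CovRep.integratedCc (ρ : CovRep S X) (h : ρ.IsRContinuous μ R) :
    UniformlyBoundedClass.CcAlgebra μ R →L[𝕜] (X →L[𝕜] X) :=
  LinearMap.mkContinuousOfExistsBound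
    { toFun := fun f => ρ.integrated μ f
      map_add' := ρ.integrated_add μ
      map_smul' := ρ.integrated_smul μ } h

/-- `(π ⋊ U)^𝓡`: the bounded representation of the crossed product determined by
`(π ⋊ U)^𝓡 (q^𝓡(f)) = π ⋊ U (f)`. -/
def CovRep.integration (ρ : CovRep S X) (h : ρ.IsRContinuous μ R) : CrossedRep μ R X where
  T := (ρ.integratedCc h).extend (UniformlyBoundedClass.CrossedProduct.incl R μ)
  T_mul a b := by
    set E := (ρ.integratedCc h).extend (UniformlyBoundedClass.CrossedProduct.incl R μ) with hE
    have hEq : ∀ f, E (UniformlyBoundedClass.CrossedProduct.incl R μ f) = ρ.integrated μ f :=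
      fun f => ContinuousLinearMap.extend_eq _
        (UniformlyBoundedClass.CrossedProduct.denseRange_incl R μ)
        (UniformlyBoundedClass.CrossedProduct.isUniformInducing_incl R μ) f
    revert b
    refine UniformlyBoundedClass.CrossedProduct.induction R μ a ?_ (fun f => ?_)
    · simp only [Set.ofPred_forall]
      exact isClosed_iInter fun b => isClosed_eq (by fun_prop) (by fun_prop)
    intro b
    refine UniformlyBoundedClass.CrossedProduct.induction R μ b ?_ (fun g => ?_)
    · exact isClosed_eq (by fun_prop) (by fun_prop)
    rw [← UniformlyBoundedClass.CrossedProduct.incl_mul, hEq, hEq, hEq]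
    exact ρ.integrated_conv μ f g

theorem CovRep.integration_q (ρ : CovRep S X) (h : ρ.IsRContinuous μ R) (f : C_c(G, A)) :
    (ρ.integration h).T (R.q μ f) = ρ.integrated μ f :=
  ContinuousLinearMap.extend_eq _ (UniformlyBoundedClass.CrossedProduct.denseRange_incl R μ)
    (UniformlyBoundedClass.CrossedProduct.isUniformInducing_incl R μ) _

end Integration

variable (R : UniformlyBoundedClass.{u, v} S)

/-- The class of all `𝓡`-continuous covariant representations (in Banach spaces in `Type w`). -/
abbrev RContinuousCovRep : Type _ :=
  Σ X : BanachSpace.{u, w} 𝕜, {ρ : CovRep S X // ρ.IsRContinuous μ R}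

/-- The class of all bounded representations of the crossed product (in Banach spaces in
`Type w`). -/
abbrev BoundedCrossedRep : Type _ := Σ X : BanachSpace.{u, w} 𝕜, CrossedRep μ R X

/-- The assignment `(π, U) ↦ (π ⋊ U)^𝓡`. -/
def integrationMap (p : RContinuousCovRep.{u, v, w} μ R) : BoundedCrossedRep.{u, v, w} μ R :=
  ⟨p.1, p.2.1.integration p.2.2⟩

end Main

end

end CrossedProd

/-!
Uniform boundedness of `R` gives `σ(f) ≤ K ‖f‖₁`, so the two seminorms on `C_c(G, A)` are equivalent
and the completion `(A ⋊ G)^R` is `L¹(G, A)`; the product of two integrable functions is computed by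
writing them as almost everywhere absolutely convergent series of functions in `C_c(G, A)`.

A covariant representation is recovered from its integrated form by testing on the functions
`φ(s⁻¹ ·) ⊗ a`, with `φ ≥ 0` of integral one: their integrated forms tend strongly to `π(a) U_s` as
the supports of the `φ` shrink to the identity. This gives injectivity and the statements on
invariant subspaces, intertwining operators and adjoints. For surjectivity, left multiplication by
`a` and the twisted translations `f ↦ α_s ∘ f(s⁻¹ ·)` are bounded left centralizers of the crossed
product, which has a bounded approximate left identity. A non-degenerate representation `T` of the
crossed product therefore turns them into operators `π(a)` and `U_s`, and Fubini's theorem for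
`f * g` shows that the integrated form of `(π, U)` is `T`.
-/

namespace CrossedProd

noncomputable section

universe u v w

open scoped Pointwise

/-! ## Strong limits of bounded families of operators -/

section StrongLimits

variable {𝕜 : Type*} [RCLike 𝕜] {X Y : Type*} [NormedAddCommGroup X] [NormedSpace 𝕜 X]
  [NormedAddCommGroup Y] [NormedSpace 𝕜 Y] {ι : Type*} {l : Filter ι} {F : ι → X →L[𝕜] Y} {K : ℝ}
  {s : Set X}

theorem isClosed_setOf_tendsto_apply (hK : ∀ᶠ i in l, ‖F i‖ ≤ K) (V : X →L[𝕜] Y) :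
    IsClosed {x | Tendsto (fun i => F i x) l (𝓝 (V x))} := by
  classical
  let F' : ι → X →L[𝕜] Y := fun i => if ‖F i‖ ≤ K then F i else 0
  have hF' : ∀ i, ‖F' i‖ ≤ max K 0 := fun i => by
    by_cases hi : ‖F i‖ ≤ K <;> simp [F', hi]
  have hFF' : F =ᶠ[l] F' := hK.mono fun i hi => by simp [F', hi]
  have hbound : ∃ C, ∀ i, ‖F' i‖ ≤ C := ⟨max K 0, hF'⟩
  have hequi : Equicontinuous ((↑) ∘ F') := ((NormedSpace.equicontinuous_TFAE F').out 5 1).1 hbound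
  convert hequi.isClosed_setOfPred_tendsto (l := l) V.continuous using 3 with x
  exact tendsto_congr' (hFF'.mono fun i hi => congrArg (· x) hi)

theorem tendsto_apply_of_dense_span (hK : ∀ᶠ i in l, ‖F i‖ ≤ K) (V : X →L[𝕜] Y)
    (hs : Dense (Submodule.span 𝕜 s : Set X))
    (h : ∀ x ∈ s, Tendsto (fun i => F i x) l (𝓝 (V x))) (x : X) :
    Tendsto (fun i => F i x) l (𝓝 (V x)) := by
  refine (isClosed_setOf_tendsto_apply hK V).closure_subset_iff.2 (fun y hy => ?_) (hs x)
  simp only [Set.mem_ofPred_eq]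
  induction hy using Submodule.span_induction with
  | mem y hy => exact h y hy
  | zero => simpa using tendsto_const_nhds
  | add y z _ _ hy hz => simpa using hy.add hz
  | smul c y _ hy => simpa using hy.const_smul c

theorem exists_tendsto_apply_of_mem_span (h : ∀ x ∈ s, ∃ y, Tendsto (fun i => F i x) l (𝓝 y))
    {x : X} (hx : x ∈ Submodule.span 𝕜 s) : ∃ y, Tendsto (fun i => F i x) l (𝓝 y) := by
  induction hx using Submodule.span_induction with
  | mem x hx => exact h x hx
  | zero => exact ⟨0, by simpa using tendsto_const_nhds⟩
  | add x y _ _ hx hy =>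
    obtain ⟨⟨x', hx'⟩, y', hy'⟩ := And.intro hx hy
    exact ⟨x' + y', by simpa using hx'.add hy'⟩
  | smul c x _ hx =>
    obtain ⟨x', hx'⟩ := hx
    exact ⟨c • x', by simpa using hx'.const_smul c⟩

theorem exists_strong_limit_of_dense_span [CompleteSpace Y] [l.NeBot]
    (hK : ∀ᶠ i in l, ‖F i‖ ≤ K) (hs : Dense (Submodule.span 𝕜 s : Set X))
    (h : ∀ x ∈ s, ∃ y, Tendsto (fun i => F i x) l (𝓝 y)) :
    ∃ V : X →L[𝕜] Y, (∀ x, Tendsto (fun i => F i x) l (𝓝 (V x))) ∧ ‖V‖ ≤ K := by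
  have hbound : ∀ x y, Tendsto (fun i => F i x) l (𝓝 y) → ‖y‖ ≤ K * ‖x‖ := fun x y hy =>
    le_of_tendsto hy.norm (hK.mono fun i hi => ((F i).le_opNorm x).trans (by gcongr))
  choose V₀ hV₀ using fun x : Submodule.span 𝕜 s => exists_tendsto_apply_of_mem_span h x.2
  let V₁ : Submodule.span 𝕜 s →L[𝕜] Y := LinearMap.mkContinuous
    { toFun := V₀
      map_add' := fun x y =>
        tendsto_nhds_unique (hV₀ (x + y)) (by simpa using (hV₀ x).add (hV₀ y))
      map_smul' := fun c x =>
        tendsto_nhds_unique (hV₀ (c • x)) (by simpa using (hV₀ x).const_smul c) }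
    K fun x => hbound x _ (hV₀ x)
  let V : X →L[𝕜] Y := V₁.extend (Submodule.span 𝕜 s).subtypeL
  have hV₁ : ∀ x, V ((Submodule.span 𝕜 s).subtypeL x) = V₁ x :=
    V₁.extend_eq hs.denseRange_val isUniformEmbedding_subtype_val.isUniformInducing
  have hV : ∀ x, Tendsto (fun i => F i x) l (𝓝 (V x)) :=
    tendsto_apply_of_dense_span hK V hs fun x hx => by
      have := hV₀ ⟨x, Submodule.subset_span hx⟩
      rwa [← show V x = V₀ _ from hV₁ ⟨x, Submodule.subset_span hx⟩] at this
  have hK0 : 0 ≤ K := hK.exists.elim fun i hi => (norm_nonneg _).trans hi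
  exact ⟨V, hV, V.opNorm_le_bound hK0 fun x => hbound x _ (hV x)⟩

end StrongLimits

/-! ## Approximate identities on the group -/

section Group

variable {G : Type*} [TopologicalSpace G] [MeasurableSpace G]

/-- The continuous compactly supported densities of probability measures supported in `V`. -/
def probDensities (μ : Measure G) (V : Set G) : Set C_c(G, ℝ) :=
  {φ | (∀ s, 0 ≤ φ s) ∧ ∫ s, φ s ∂μ = 1 ∧ tsupport φ ⊆ V}

/-- The approximate identity of the group: probability densities whose support shrinks to `1`. -/
def deltaFilter [One G] (μ : Measure G) : Filter C_c(G, ℝ) := (𝓝 (1 : G)).lift' (probDensities μ)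

theorem eventually_deltaFilter [One G] (μ : Measure G) {V : Set G} (hV : V ∈ 𝓝 (1 : G)) :
    ∀ᶠ φ in deltaFilter μ, φ ∈ probDensities μ V :=
  mem_lift' hV

theorem monotone_probDensities (μ : Measure G) : Monotone (probDensities μ) :=
  fun _ _ h _ hφ => ⟨hφ.1, hφ.2.1, hφ.2.2.trans h⟩

variable [BorelSpace G] (μ : Measure G)

theorem nonempty_probDensities [Group G] [IsTopologicalGroup G] [LocallyCompactSpace G]
    [μ.IsHaarMeasure] {V : Set G} (hV : V ∈ 𝓝 (1 : G)) : (probDensities μ V).Nonempty := by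
  obtain ⟨f, hf_one, hfc, hf_supp, hf⟩ := exists_continuousMap_one_of_isCompact_subset_isOpen
    (isCompact_singleton (x := (1 : G))) isOpen_interior
    (Set.singleton_subset_iff.2 (mem_interior_iff_mem_nhds.2 hV))
  have hpos : 0 < ∫ s, f s ∂μ :=
    f.continuous.integral_pos_of_hasCompactSupport_nonneg_nonzero hfc (fun s => (hf s).1)
      (x := 1) (by simp [hf_one rfl])
  refine ⟨⟨⟨fun s => (∫ s, f s ∂μ)⁻¹ * f s, by fun_prop⟩, HasCompactSupport.mul_left hfc⟩,
    fun s => ?_, ?_, ?_⟩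
  · exact mul_nonneg (inv_nonneg.2 hpos.le) (hf s).1
  · exact (integral_const_mul _ _).trans (inv_mul_cancel₀ hpos.ne')
  · exact (closure_mono fun s hs => right_ne_zero_of_mul hs).trans
      (hf_supp.trans interior_subset)

instance neBot_deltaFilter [Group G] [IsTopologicalGroup G] [LocallyCompactSpace G]
    [μ.IsHaarMeasure] : (deltaFilter μ).NeBot :=
  (lift'_neBot_iff (monotone_probDensities μ)).2 fun _ hV => nonempty_probDensities μ hV

variable [IsFiniteMeasureOnCompacts μ] {E : Type*} [NormedAddCommGroup E]
  [NormedSpace ℝ E] [CompleteSpace E] {h : G → E}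

theorem norm_integral_smul_sub_le {φ : C_c(G, ℝ)} {V : Set G} (hφ : φ ∈ probDensities μ V)
    (hc : Continuous h) {y : E} {ε : ℝ} (hε : ∀ s ∈ V, ‖h s - y‖ ≤ ε) :
    ‖∫ s, φ s • h s ∂μ - y‖ ≤ ε := by
  have hφi : Integrable φ μ := φ.continuous.integrable_of_hasCompactSupport φ.hasCompactSupport
  have hφh : Integrable (fun s => φ s • h s) μ :=
    (φ.continuous.smul hc).integrable_of_hasCompactSupport φ.hasCompactSupport.smul_right
  have hbound : ∀ s, ‖φ s • (h s - y)‖ ≤ φ s * ε := fun s => by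
    rw [norm_smul, Real.norm_of_nonneg (hφ.1 s)]
    by_cases hs : s ∈ tsupport φ
    · exact mul_le_mul_of_nonneg_left (hε s (hφ.2.2 hs)) (hφ.1 s)
    · simp [image_eq_zero_of_notMem_tsupport hs]
  calc ‖∫ s, φ s • h s ∂μ - y‖ = ‖∫ s, φ s • (h s - y) ∂μ‖ := by
        simp only [smul_sub]
        rw [integral_sub hφh (hφi.smul_const y), integral_smul_const, hφ.2.1, one_smul]
    _ ≤ ∫ s, φ s * ε ∂μ := norm_integral_le_of_norm_le (hφi.mul_const _) (.of_forall hbound)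
    _ = ε := by rw [integral_mul_const, hφ.2.1, one_mul]

theorem tendsto_integral_deltaFilter [One G] (hc : Continuous h) :
    Tendsto (fun φ : C_c(G, ℝ) => ∫ s, φ s • h s ∂μ) (deltaFilter μ) (𝓝 (h 1)) := by
  refine Metric.tendsto_nhds.2 fun ε hε => ?_
  have hV : {s | ‖h s - h 1‖ < ε / 2} ∈ 𝓝 (1 : G) := by
    simpa only [dist_eq_norm] using! Metric.tendsto_nhds.1 (hc.tendsto 1) (ε / 2) (half_pos hε)
  filter_upwards [eventually_deltaFilter μ hV] with φ hφ
  rw [dist_eq_norm]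
  exact (norm_integral_smul_sub_le μ hφ hc fun s hs => le_of_lt hs).trans_lt (half_lt_self hε)

end Group

/-! ## Estimates in the norm of `L¹` -/

section LOneEstimates

variable {α E : Type*} [TopologicalSpace α] [NormedAddCommGroup E]

theorem eventually_forall_norm_sub_le {Z : Type*} [TopologicalSpace Z] {F : Z → C_c(α, E)} {z : Z}
    (hF : Continuous fun p : Z × α => F p.1 p.2) {Q : Set α} (hQ : IsCompact Q)
    (h0 : ∀ᶠ z' in 𝓝 z, ∀ s ∉ Q, F z' s = 0) {ε : ℝ} (hε : 0 < ε) :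
    ∀ᶠ z' in 𝓝 z, ∀ s, ‖F z' s - F z s‖ ≤ ε := by
  have hc : Continuous fun p : Z × α => ‖F p.1 p.2 - F z p.2‖ :=
    (hF.sub ((F z).continuous.comp continuous_snd)).norm
  have hQε : ∀ᶠ z' in 𝓝 z, ∀ s ∈ Q, ‖F z' s - F z s‖ < ε :=
    hQ.eventually_forall_of_forall_eventually fun s _ =>
      (hc.tendsto (z, s)).eventually (gt_mem_nhds (by simpa using hε))
  filter_upwards [hQε, h0] with z' hz' hz0 s
  by_cases hs : s ∈ Q
  · exact (hz' s hs).le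
  · simp [hz0 s hs, h0.self_of_nhds s hs, hε.le]

variable [MeasurableSpace α] [OpensMeasurableSpace α] (μ : Measure α)
  [IsFiniteMeasureOnCompacts μ]

theorem integrable_norm_cc (f : C_c(α, E)) : Integrable (fun s => ‖f s‖) μ :=
  f.continuous.norm.integrable_of_hasCompactSupport f.hasCompactSupport.norm

variable [T2Space α] {Q : Set α}

theorem integral_norm_le_of_forall {f : C_c(α, E)} (hQ : IsCompact Q) {ε : ℝ}
    (h0 : ∀ s ∉ Q, f s = 0) (hε : ∀ s ∈ Q, ‖f s‖ ≤ ε) : ∫ s, ‖f s‖ ∂μ ≤ ε * μ.real Q := by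
  rw [← setIntegral_eq_integral_of_forall_compl_eq_zero (s := Q) fun _ hs => by simp [h0 _ hs]]
  calc ∫ s in Q, ‖f s‖ ∂μ ≤ ∫ _ in Q, ε ∂μ :=
        setIntegral_mono_on (integrable_norm_cc μ f).integrableOn
          (integrableOn_const hQ.measure_ne_top) hQ.measurableSet hε
    _ = ε * μ.real Q := by simp [mul_comm]

theorem tendsto_integral_norm_sub {ι : Type*} {l : Filter ι} {F : ι → C_c(α, E)} {f : C_c(α, E)}
    (hQ : IsCompact Q) (h0 : ∀ᶠ i in l, ∀ s ∉ Q, (F i - f) s = 0)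
    (hε : ∀ ε > 0, ∀ᶠ i in l, ∀ s ∈ Q, ‖(F i - f) s‖ ≤ ε) :
    Tendsto (fun i => ∫ s, ‖(F i - f) s‖ ∂μ) l (𝓝 0) := by
  refine Metric.tendsto_nhds.2 fun ε hε0 => ?_
  filter_upwards [h0, hε (ε / (μ.real Q + 1)) (by positivity)] with i hi0 hi
  rw [dist_zero_right, Real.norm_of_nonneg (by positivity)]
  calc ∫ s, ‖(F i - f) s‖ ∂μ ≤ ε / (μ.real Q + 1) * μ.real Q :=
        integral_norm_le_of_forall μ hQ hi0 hi
    _ < ε / (μ.real Q + 1) * (μ.real Q + 1) := by gcongr; linarith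
    _ = ε := by field_simp

theorem tendsto_integral_norm_sub_of_continuous {Z : Type*} [TopologicalSpace Z]
    {F : Z → C_c(α, E)} {z : Z} (hF : Continuous fun p : Z × α => F p.1 p.2) (hQ : IsCompact Q)
    (h0 : ∀ᶠ z' in 𝓝 z, ∀ s ∉ Q, F z' s = 0) :
    Tendsto (fun z' => ∫ s, ‖(F z' - F z) s‖ ∂μ) (𝓝 z) (𝓝 0) := by
  refine tendsto_integral_norm_sub μ hQ ?_ fun ε hε => ?_
  · filter_upwards [h0] with z' hz' s hs
    simp [hz' s hs, h0.self_of_nhds s hs]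
  · filter_upwards [eventually_forall_norm_sub_le hF hQ h0 hε] with z' hz' s _ using hz' s

end LOneEstimates

/-! ## Elementary functions, left multiplications and translations -/

section Bump

variable {G : Type*} [Group G] [TopologicalSpace G] [IsTopologicalGroup G] {E : Type*}
  [NormedAddCommGroup E] [NormedSpace ℝ E]

/-- The translated elementary tensor `t ↦ φ(s⁻¹t) a`. -/
def bump (φ : C_c(G, ℝ)) (s : G) (a : E) : C_c(G, E) where
  toFun t := φ (s⁻¹ * t) • a
  continuous_toFun := by fun_prop
  hasCompactSupport' :=
    (φ.hasCompactSupport.comp_homeomorph (Homeomorph.mulLeft s⁻¹)).smul_right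

theorem bump_apply (φ : C_c(G, ℝ)) (s : G) (a : E) (t : G) : bump φ s a t = φ (s⁻¹ * t) • a := rfl

theorem integral_norm_bump [MeasurableSpace G] [BorelSpace G] (μ : Measure G)
    [μ.IsMulLeftInvariant] {φ : C_c(G, ℝ)} {V : Set G} (hφ : φ ∈ probDensities μ V) (s : G)
    (a : E) : ∫ t, ‖bump φ s a t‖ ∂μ = ‖a‖ := by
  simp only [bump_apply, norm_smul, Real.norm_of_nonneg (hφ.1 _)]
  rw [integral_mul_const, integral_mul_left_eq_self (fun t => φ t) s⁻¹, hφ.2.1, one_mul]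

end Bump

section LeftMul

variable {α A : Type*} [TopologicalSpace α] [NonUnitalNormedRing A]

/-- Left multiplication of the values of a function by `a`. -/
def leftMul (a : A) (f : C_c(α, A)) : C_c(α, A) where
  toFun t := a * f t
  continuous_toFun := by fun_prop
  hasCompactSupport' := f.hasCompactSupport.mul_left

theorem leftMul_apply (a : A) (f : C_c(α, A)) (t : α) : leftMul a f t = a * f t := rfl

theorem leftMul_leftMul (a b : A) (f : C_c(α, A)) :
    leftMul a (leftMul b f) = leftMul (a * b) f := by
  ext r; simp only [leftMul_apply, mul_assoc]

variable {l : Filter A} {M : ℝ}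

-- Boundedness of the approximate identity makes the convergence `x * b - b → 0` locally uniform.
theorem tendsto_mul_sub_prod_nhds (hM : ∀ᶠ x in l, ‖x‖ ≤ M)
    (hl : ∀ a : A, Tendsto (fun x => x * a) l (𝓝 a)) (a : A) :
    Tendsto (fun p : A × A => p.1 * p.2 - p.2) (l ×ˢ 𝓝 a) (𝓝 0) := by
  have hsub : Tendsto (fun p : A × A => p.2 - a) (l ×ˢ 𝓝 a) (𝓝 0) := by
    simpa using (tendsto_snd (f := l) (g := 𝓝 a)).sub_const a
  have hbdd : IsBoundedUnder (· ≤ ·) (l ×ˢ 𝓝 a) fun p : A × A => ‖p.1‖ :=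
    isBoundedUnder_of_eventually_le (hM.prod_inl _)
  have hfix : Tendsto (fun p : A × A => p.1 * a - a) (l ×ˢ 𝓝 a) (𝓝 0) := by
    simpa using ((hl a).comp tendsto_fst).sub_const a
  have hmul := isBoundedUnder_le_mul_tendsto_zero hbdd hsub
  convert (hmul.add hfix).sub hsub using 2 <;> simp [mul_sub]

theorem eventually_forall_norm_leftMul_sub_le (hM : ∀ᶠ x in l, ‖x‖ ≤ M)
    (hl : ∀ a : A, Tendsto (fun x => x * a) l (𝓝 a)) (f : C_c(α, A)) {ε : ℝ} (hε : 0 < ε) :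
    ∀ᶠ x in l, ∀ s, ‖x * f s - f s‖ ≤ ε := by
  have hcompact : ∀ᶠ p : A × α in l ×ˢ 𝓝ˢ (tsupport f), ‖p.1 * f p.2 - f p.2‖ < ε :=
    f.hasCompactSupport.isCompact.mem_prod_nhdsSet_of_forall fun s _ =>
      ((tendsto_mul_sub_prod_nhds hM hl (f s)).norm.comp
        (tendsto_id.prodMap (f.continuous.tendsto s))).eventually
        (gt_mem_nhds (by simpa using hε))
  filter_upwards [hcompact.curry] with x hx s
  by_cases hs : s ∈ tsupport f
  · exact (hx.self_of_nhdsSet s hs).le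
  · simp [image_eq_zero_of_notMem_tsupport hs, hε.le]

theorem tendsto_leftMul [MeasurableSpace α] [OpensMeasurableSpace α] [T2Space α] (μ : Measure α)
    [IsFiniteMeasureOnCompacts μ] (hM : ∀ᶠ x in l, ‖x‖ ≤ M)
    (hl : ∀ a : A, Tendsto (fun x => x * a) l (𝓝 a)) (f : C_c(α, A)) :
    Tendsto (fun x => ∫ s, ‖(leftMul x f - f) s‖ ∂μ) l (𝓝 0) := by
  refine tendsto_integral_norm_sub μ f.hasCompactSupport.isCompact (.of_forall fun x s hs => ?_)
    fun ε hε => ?_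
  · simp [leftMul_apply, image_eq_zero_of_notMem_tsupport hs]
  · filter_upwards [eventually_forall_norm_leftMul_sub_le hM hl f hε] with x hx s _ using hx s

end LeftMul

section Translate

variable {𝕜 : Type*} [RCLike 𝕜] {A : Type*} [NonUnitalNormedRing A] [NormedSpace 𝕜 A]
  {G : Type*} [Group G] [TopologicalSpace G] (S : DynSystem 𝕜 A G)

theorem act_act (s t : G) (a : A) : S.act s (S.act t a) = S.act (s * t) a := by
  rw [map_mul]; rfl

variable [IsTopologicalGroup G]

/-- The translation `(s · f)(t) = α_s(f(s⁻¹t))`. -/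
def translate (s : G) (f : C_c(G, A)) : C_c(G, A) where
  toFun t := S.act s (f (s⁻¹ * t))
  continuous_toFun := by fun_prop
  hasCompactSupport' :=
    (f.hasCompactSupport.comp_homeomorph (Homeomorph.mulLeft s⁻¹)).comp_left (map_zero (S.act s))

theorem translate_apply (s : G) (f : C_c(G, A)) (t : G) :
    translate S s f t = S.act s (f (s⁻¹ * t)) := rfl

theorem translate_one (f : C_c(G, A)) : translate S 1 f = f := by
  ext t; simp [translate_apply]

theorem translate_translate (s t : G) (f : C_c(G, A)) :
    translate S s (translate S t f) = translate S (s * t) f := by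
  ext r; simp only [translate_apply, act_act, mul_inv_rev, mul_assoc]

theorem leftMul_act (s : G) (a : A) (f : C_c(G, A)) :
    leftMul (S.act s a) f = translate S s (leftMul a (translate S s⁻¹ f)) := by
  ext r; simp [leftMul_apply, translate_apply, act_act, S.act_mul]

theorem translate_eq_zero (f : C_c(G, A)) {K : Set G} {r s : G} (hr : r ∈ K)
    (hs : s ∉ K * tsupport f) : translate S r f s = 0 := by
  have : r⁻¹ * s ∉ tsupport f := fun h => hs (Set.mem_mul.2 ⟨r, hr, _, h, by group⟩)
  simp [translate_apply, image_eq_zero_of_notMem_tsupport this]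

theorem translate_bump [NormedSpace ℝ A] [IsScalarTower ℝ 𝕜 A] (φ : C_c(G, ℝ)) (s r : G) (a : A) :
    translate S r (bump φ s a) = bump φ (r * s) (S.act r a) := by
  ext t
  simp only [translate_apply, bump_apply, mul_inv_rev, mul_assoc]
  rw [← algebraMap_smul 𝕜 (φ _) a, map_smul, algebraMap_smul]

end Translate

section Convolution

variable {𝕜 : Type*} [RCLike 𝕜]
  {A : Type*} [NonUnitalNormedRing A] [NormedSpace 𝕜 A] [NormedSpace ℝ A] [IsScalarTower ℝ 𝕜 A]
  [IsScalarTower 𝕜 A A] [SMulCommClass 𝕜 A A] [CompleteSpace A]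
  {G : Type*} [Group G] [TopologicalSpace G] [IsTopologicalGroup G] [LocallyCompactSpace G]
  [T2Space G] [MeasurableSpace G] [BorelSpace G] (S : DynSystem 𝕜 A G)

theorem continuous_translate (f : C_c(G, A)) :
    Continuous fun p : G × G => translate S p.1 f p.2 :=
  S.continuous_comp (p := Prod.fst) (q := fun p : G × G => f (p.1⁻¹ * p.2))
    continuous_fst (by fun_prop)

variable (μ : Measure G) [μ.IsHaarMeasure]

theorem leftMul_conv (a : A) (f g : C_c(G, A)) :
    leftMul a (twistedConv S μ f g) = twistedConv S μ (leftMul a f) g := by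
  ext s
  have hcomm := ContinuousLinearMap.integral_comp_comm (ContinuousLinearMap.mul 𝕜 A a)
    (integrable_convKernel S μ f g s)
  simp only [ContinuousLinearMap.mul_apply'] at hcomm
  rw [leftMul_apply, twistedConv_apply, twistedConv_apply, ← hcomm]
  simp only [convKernel, leftMul_apply, mul_assoc]

theorem translate_conv (r : G) (f g : C_c(G, A)) :
    translate S r (twistedConv S μ f g) = twistedConv S μ (translate S r f) g := by
  ext s
  rw [translate_apply, twistedConv_apply, twistedConv_apply,
    ← ContinuousLinearMap.integral_comp_comm (S.act r) (integrable_convKernel S μ f g (r⁻¹ * s)),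
    ← integral_mul_left_eq_self (convKernel S (translate S r f) g s) r]
  simp only [convKernel, translate_apply, S.act_mul, act_act, mul_inv_rev, mul_assoc,
    inv_mul_cancel_left]

theorem tendsto_translate (f : C_c(G, A)) (r : G) :
    Tendsto (fun r' => ∫ s, ‖(translate S r' f - translate S r f) s‖ ∂μ) (𝓝 r) (𝓝 0) := by
  obtain ⟨K, hK, hr⟩ := exists_compact_mem_nhds r
  refine tendsto_integral_norm_sub_of_continuous μ (F := fun r' => translate S r' f)
    (continuous_translate S f) (hK.mul f.hasCompactSupport.isCompact) ?_
  filter_upwards [hr] with r' hr' s hs using translate_eq_zero S f hr' hs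

theorem bump_one_conv_apply (φ : C_c(G, ℝ)) (a : A) (f : C_c(G, A)) (s : G) :
    twistedConv S μ (bump φ 1 a) f s = ∫ r, φ r • (a * translate S r f s) ∂μ := by
  have : IsScalarTower ℝ A A := ⟨fun c x y => by
    rw [← algebraMap_smul 𝕜 c x, ← algebraMap_smul 𝕜 c (x • y), smul_assoc]⟩
  rw [twistedConv_apply]
  simp [convKernel, bump_apply, translate_apply, smul_mul_assoc]

theorem bump_one_conv_eq_zero {K : Set G} {φ : C_c(G, ℝ)} (hφ : tsupport φ ⊆ K) (a : A)
    (f : C_c(G, A)) {s : G} (hs : s ∉ K * tsupport f) :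
    twistedConv S μ (bump φ 1 a) f s = 0 := by
  rw [bump_one_conv_apply]
  refine integral_eq_zero_of_ae (.of_forall fun r => ?_)
  by_cases hr : r ∈ tsupport φ
  · simp [translate_eq_zero S f (hφ hr) hs]
  · simp [image_eq_zero_of_notMem_tsupport hr]

theorem norm_bump_one_conv_sub_le {φ : C_c(G, ℝ)} {V : Set G} (hφ : φ ∈ probDensities μ V)
    (a : A) (f : C_c(G, A)) {s : G} {ε : ℝ} (hε : ∀ r ∈ V, ‖translate S r f s - f s‖ ≤ ε) :
    ‖twistedConv S μ (bump φ 1 a) f s - a * f s‖ ≤ ‖a‖ * ε := by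
  have hcont : Continuous fun r => translate S r f s :=
    (continuous_translate S f).comp (by fun_prop : Continuous fun r => (r, s))
  rw [bump_one_conv_apply]
  refine norm_integral_smul_sub_le μ hφ (continuous_const.mul hcont) fun r hr => ?_
  rw [Pi.mul_apply, ← mul_sub]
  exact (norm_mul_le _ _).trans (mul_le_mul_of_nonneg_left (hε r hr) (norm_nonneg a))

theorem tendsto_bump_one_conv {l : Filter A} {M : ℝ} (hM : ∀ᶠ x in l, ‖x‖ ≤ M)
    (hl : ∀ a : A, Tendsto (fun x => x * a) l (𝓝 a)) (f : C_c(G, A)) :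
    Tendsto (fun p : C_c(G, ℝ) × A => ∫ s, ‖(twistedConv S μ (bump p.1 1 p.2) f - f) s‖ ∂μ)
      (deltaFilter μ ×ˢ l) (𝓝 0) := by
  obtain ⟨K, hK, h1⟩ := exists_compact_mem_nhds (1 : G)
  have hKf := hK.mul f.hasCompactSupport.isCompact
  refine tendsto_integral_norm_sub μ hKf ?_ fun ε hε => ?_
  · filter_upwards [(eventually_deltaFilter μ h1).prod_inl l] with p hp s hs
    have hfs : f s = 0 := by
      simpa only [translate_one] using translate_eq_zero S f (mem_of_mem_nhds h1) hs
    simp [hfs, bump_one_conv_eq_zero S μ hp.2.2 p.2 f hs]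
  · have hV : ∀ᶠ r in 𝓝 (1 : G), ∀ s, ‖translate S r f s - f s‖ ≤ ε / 2 / (|M| + 1) := by
      have := eventually_forall_norm_sub_le
        (F := fun r => translate S r f) (continuous_translate S f) hKf
        (by filter_upwards [h1] with r hr s hs using translate_eq_zero S f hr hs)
        (show 0 < ε / 2 / (|M| + 1) by positivity)
      rwa [translate_one] at this
    filter_upwards [(eventually_deltaFilter μ hV).prod_inl l,
      ((eventually_forall_norm_leftMul_sub_le hM hl f (half_pos hε)).and hM).prod_inr _]
      with ⟨φ, a⟩ hφ ⟨haf, haM⟩ s _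
    calc ‖(twistedConv S μ (bump φ 1 a) f - f) s‖
        ≤ ‖twistedConv S μ (bump φ 1 a) f s - a * f s‖ + ‖a * f s - f s‖ :=
          norm_sub_le_norm_sub_add_norm_sub _ _ _
      _ ≤ (|M| + 1) * (ε / 2 / (|M| + 1)) + ε / 2 := by
          gcongr
          · refine (norm_bump_one_conv_sub_le S μ hφ a f fun r hr => hr s).trans ?_
            gcongr
            linarith [le_abs_self M]
          · exact haf s
      _ = ε := by field_simp; ring

end Convolution

/-! ## Integrated forms of elementary functions -/

namespace CovRep

section Pointwise

variable {𝕜 : Type u} [RCLike 𝕜] {A : Type*} [NonUnitalNormedRing A] [NormedSpace 𝕜 A]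
  {G : Type*} [Group G] [TopologicalSpace G] {S : DynSystem 𝕜 A G} {X : BanachSpace.{u, v} 𝕜}
  (ρ : CovRep S X)

theorem U_mul_apply (s t : G) (x : X) : ρ.U (s * t) x = ρ.U s (ρ.U t x) := by
  rw [map_mul]; rfl

theorem U_one_apply (x : X) : ρ.U 1 x = x := by rw [map_one]; rfl

theorem tendsto_π_of_isNonDegenerate (hρ : ρ.IsNonDegenerate) {l : Filter A} {M : ℝ}
    (hM : ∀ᶠ x in l, ‖x‖ ≤ M) (hl : ∀ a : A, Tendsto (fun x => x * a) l (𝓝 a)) (x : X) :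
    Tendsto (fun u => ρ.π u x) l (𝓝 x) := by
  refine tendsto_apply_of_dense_span (F := fun u => ρ.π u) (K := ‖ρ.π‖ * M)
    (hM.mono fun u hu => (ρ.π.le_opNorm u).trans (by gcongr)) (ContinuousLinearMap.id 𝕜 X) hρ ?_ x
  rintro _ ⟨b, x, rfl⟩
  have hcont : Continuous fun a => ρ.π a x := ρ.π.continuous.clm_apply continuous_const
  simpa [Function.comp_def, ρ.π_mul] using (hcont.tendsto b).comp (hl b)

end Pointwise

variable {𝕜 : Type u} [RCLike 𝕜]
  {A : Type*} [NonUnitalNormedRing A] [NormedSpace 𝕜 A] [NormedSpace ℝ A] [IsScalarTower ℝ 𝕜 A]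
  [IsScalarTower 𝕜 A A] [SMulCommClass 𝕜 A A] [CompleteSpace A]
  {G : Type*} [Group G] [TopologicalSpace G] [IsTopologicalGroup G] [LocallyCompactSpace G]
  [T2Space G] [MeasurableSpace G] [BorelSpace G]
  {S : DynSystem 𝕜 A G} {X : BanachSpace.{u, v} 𝕜} (ρ : CovRep S X)
  (μ : Measure G) [μ.IsHaarMeasure]

theorem integrated_bump (φ : C_c(G, ℝ)) (s : G) (a : A) (x : X) :
    ρ.integrated μ (bump φ s a) x = ∫ t, φ t • ρ.π a (ρ.U (s * t) x) ∂μ := by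
  rw [integrated_apply, ← integral_mul_left_eq_self _ s]
  refine integral_congr_ae (.of_forall fun t => ?_)
  simp only [bump_apply, inv_mul_cancel_left]
  rw [← algebraMap_smul 𝕜 (φ t) a, map_smul, smul_apply, algebraMap_smul]

theorem tendsto_integrated_bump (s : G) (a : A) (x : X) :
    Tendsto (fun φ => ρ.integrated μ (bump φ s a) x) (deltaFilter μ) (𝓝 (ρ.π a (ρ.U s x))) := by
  simp only [integrated_bump]
  simpa only [mul_one] using tendsto_integral_deltaFilter μ (h := fun t => ρ.π a (ρ.U (s * t) x))
    (ρ.continuous_comp (by fun_prop) continuous_const continuous_const)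

theorem integrated_leftMul (a : A) (f : C_c(G, A)) :
    ρ.integrated μ (leftMul a f) = ρ.π a * ρ.integrated μ f := by
  ext x
  simp only [mul_apply_eq_comp, integrated_apply]
  rw [← ContinuousLinearMap.integral_comp_comm _ (ρ.integrable μ f x)]
  simp only [leftMul_apply, ρ.π_mul, mul_apply_eq_comp]

theorem integrated_translate (r : G) (f : C_c(G, A)) :
    ρ.integrated μ (translate S r f) = ρ.U r * ρ.integrated μ f := by
  ext x
  simp only [mul_apply_eq_comp, integrated_apply]
  rw [← ContinuousLinearMap.integral_comp_comm _ (ρ.integrable μ f x),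
    ← integral_mul_left_eq_self _ r]
  simp [translate_apply, covariant_apply]

theorem norm_integrated_le {C D : ℝ} (hC : 0 ≤ C) (hD : 0 ≤ D) (hπ : ‖ρ.π‖ ≤ C)
    (hU : ∀ r, ‖ρ.U r‖ ≤ D) (f : C_c(G, A)) : ‖ρ.integrated μ f‖ ≤ C * D * ∫ s, ‖f s‖ ∂μ :=
  ContinuousLinearMap.opNorm_le_bound _
    (mul_nonneg (mul_nonneg hC hD) (integral_nonneg fun _ => norm_nonneg _))
    (ρ.norm_integral_le μ f hC hπ fun s _ => hU s)

end CovRep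

/-! ## Compactly supported functions in `L¹` -/

section CompactSupportDense

variable {α E : Type*} [NormedAddCommGroup E] [NormedSpace ℝ E]

theorem norm_smul_sub_indicator_le {g : α → ℝ} {s t V : Set α} (hst : s ⊆ t)
    (hg : ∀ x, g x ∈ Set.Icc 0 1) (hg1 : Set.EqOn g 1 s) (hg0 : Set.EqOn g 0 Vᶜ) (c : E) (x : α) :
    ‖g x • c - t.indicator (fun _ => c) x‖ ≤ ‖(V \ s ∪ t \ s).indicator (fun _ => c) x‖ := by
  obtain ⟨h0, h1⟩ := hg x
  by_cases hs : x ∈ s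
  · simp [hg1 hs, hs, hst hs]
  by_cases ht : x ∈ t
  · rw [Set.indicator_of_mem ht, Set.indicator_of_mem (.inr ⟨ht, hs⟩),
      show g x • c - c = (g x - 1) • c by rw [sub_smul, one_smul], norm_smul]
    exact mul_le_of_le_one_left (norm_nonneg c) (abs_le.2 ⟨by linarith, by linarith⟩)
  by_cases hV : x ∈ V
  · rw [Set.indicator_of_notMem ht, Set.indicator_of_mem (.inl ⟨hV, hs⟩), sub_zero, norm_smul]
    exact mul_le_of_le_one_left (norm_nonneg c) (abs_le.2 ⟨by linarith, h1⟩)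
  · simp [hg0 hV, ht]

variable [TopologicalSpace α] [T2Space α] [LocallyCompactSpace α] [MeasurableSpace α]
  [BorelSpace α] {μ : Measure α} [μ.Regular]

theorem exists_hasCompactSupport_eLpNorm_sub_indicator_le (c : E) {t : Set α}
    (ht : MeasurableSet t) (htμ : μ t < ⊤) {ε : ENNReal} (hε : ε ≠ 0) :
    ∃ g : α → E, eLpNorm (g - t.indicator fun _ => c) 1 μ ≤ ε ∧ Continuous g ∧
      HasCompactSupport g := by
  obtain ⟨η, hη0, hη⟩ := exists_eLpNorm_indicator_le (μ := μ) ENNReal.one_ne_top c hε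
  have hη2 : (η : ENNReal) / 2 ≠ 0 := (ENNReal.half_pos (ENNReal.coe_pos.2 hη0).ne').ne'
  obtain ⟨s, hst, hs, hs', htsη⟩ := ht.exists_isCompact_isClosed_sdiff_lt htμ.ne hη2
  obtain ⟨V, hsV, hV, -, hVsη⟩ := hs'.measurableSet.exists_isOpen_sdiff_lt
    ((measure_mono hst).trans_lt htμ).ne hη2
  obtain ⟨g, hg1, hg0, hgc, hg⟩ := exists_continuous_one_zero_of_isCompact hs
    hV.isClosed_compl (Set.disjoint_compl_right_iff_subset.2 hsV)
  refine ⟨fun x => g x • c, ?_, by fun_prop, hgc.smul_right⟩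
  refine (eLpNorm_mono fun x => norm_smul_sub_indicator_le hst hg hg1 hg0 c x).trans (hη _ ?_)
  calc μ (V \ s ∪ t \ s) ≤ μ (V \ s) + μ (t \ s) := measure_union_le _ _
    _ ≤ η / 2 + η / 2 := add_le_add hVsη.le htsη.le
    _ = η := ENNReal.add_halves _

theorem exists_hasCompactSupport_eLpNorm_sub_le {f : α → E} (hf : MemLp f 1 μ) {ε : ENNReal}
    (hε : ε ≠ 0) : ∃ g : α → E, eLpNorm (f - g) 1 μ ≤ ε ∧ Continuous g ∧ HasCompactSupport g := by
  refine hf.induction_dense ENNReal.one_ne_top (fun g => Continuous g ∧ HasCompactSupport g)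
    (fun c t ht htμ _ hδ => ?_) (fun f g hf hg => ?_) (fun f hf => ?_) hε
  · exact exists_hasCompactSupport_eLpNorm_sub_indicator_le c ht htμ hδ
  · exact ⟨hf.1.add hg.1, hf.2.add hg.2⟩
  · exact (hf.1.memLp_of_hasCompactSupport (p := 1) (μ := μ) hf.2).aestronglyMeasurable

end CompactSupportDense

section ToLOne

variable (𝕜 : Type*) [RCLike 𝕜] {α E : Type*} [TopologicalSpace α] [MeasurableSpace α]
  [OpensMeasurableSpace α] [NormedAddCommGroup E] [NormedSpace 𝕜 E]
  (μ : Measure α) [IsFiniteMeasureOnCompacts μ]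

/-- The class in `L¹` of a compactly supported continuous function. -/
def toLOne : C_c(α, E) →ₗ[𝕜] Lp E 1 μ where
  toFun f := (f.continuous.memLp_of_hasCompactSupport f.hasCompactSupport).toLp f
  map_add' _ _ := rfl
  map_smul' _ _ := rfl

theorem coeFn_toLOne (f : C_c(α, E)) : toLOne 𝕜 μ f =ᵐ[μ] f :=
  MemLp.coeFn_toLp (f.continuous.memLp_of_hasCompactSupport f.hasCompactSupport)

theorem norm_toLOne (f : C_c(α, E)) : ‖toLOne 𝕜 μ f‖ = ∫ s, ‖f s‖ ∂μ := by
  rw [L1.norm_eq_integral_norm]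
  exact integral_congr_ae ((coeFn_toLOne 𝕜 μ f).mono fun s hs => congrArg norm hs)

end ToLOne

theorem denseRange_toLOne (𝕜 : Type*) [RCLike 𝕜] {α E : Type*} [TopologicalSpace α]
    [MeasurableSpace α] [BorelSpace α] [T2Space α] [LocallyCompactSpace α] [NormedAddCommGroup E]
    [NormedSpace 𝕜 E] [NormedSpace ℝ E] (μ : Measure α) [μ.Regular] :
    DenseRange (toLOne 𝕜 μ : C_c(α, E) → Lp E 1 μ) := by
  intro F
  rw [Metric.mem_closure_iff]
  intro ε hε
  obtain ⟨g, hgε, hg, hgc⟩ := exists_hasCompactSupport_eLpNorm_sub_le (Lp.memLp F)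
    (ε := ENNReal.ofReal (ε / 2)) (by simpa using hε)
  let g' : C_c(α, E) := ⟨⟨g, hg⟩, hgc⟩
  refine ⟨_, ⟨g', rfl⟩, ?_⟩
  have hFg : ‖F - toLOne 𝕜 μ g'‖ = (eLpNorm (⇑F - g) 1 μ).toReal := by
    rw [Lp.norm_def]
    congr 1
    exact eLpNorm_congr_ae ((Lp.coeFn_sub _ _).trans
      (EventuallyEq.rfl.sub (coeFn_toLOne 𝕜 μ g')))
  calc dist F (toLOne 𝕜 μ g') = (eLpNorm (⇑F - g) 1 μ).toReal := by rw [dist_eq_norm, hFg]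
    _ ≤ (ENNReal.ofReal (ε / 2)).toReal := ENNReal.toReal_mono ENNReal.ofReal_ne_top hgε
    _ = ε / 2 := ENNReal.toReal_ofReal (half_pos hε).le
    _ < ε := half_lt_self hε

section ConvSlice

variable {𝕜 : Type u} [RCLike 𝕜]
  {A : Type*} [NonUnitalNormedRing A] [NormedSpace 𝕜 A]
  {G : Type*} [Group G] [TopologicalSpace G] [IsTopologicalGroup G] (S : DynSystem 𝕜 A G)
  (f g : C_c(G, A))

/-- The function `t ↦ f(s) α_s(g(s⁻¹t))`, whose integral over `s` is the twisted convolution. -/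
def convSlice (s : G) : C_c(G, A) :=
  leftMul (f s) (translate S s g)

theorem convSlice_apply (s t : G) : convSlice S f g s t = convKernel S f g t s := rfl

theorem convKernel_eq_zero {s t : G} (h : (s, t) ∉ tsupport f ×ˢ (tsupport f * tsupport g)) :
    convKernel S f g t s = 0 := by
  by_cases hs : s ∈ tsupport f
  · have ht : t ∉ tsupport f * tsupport g := fun ht => h ⟨hs, ht⟩
    simp [← convSlice_apply, convSlice, leftMul_apply, translate_eq_zero S g hs ht]
  · simp [convKernel, image_eq_zero_of_notMem_tsupport hs]

theorem hasCompactSupport_convKernel_swap :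
    HasCompactSupport (Function.uncurry fun s t => convKernel S f g t s) :=
  HasCompactSupport.intro
    (f.hasCompactSupport.isCompact.prod
      (f.hasCompactSupport.isCompact.mul g.hasCompactSupport.isCompact))
    fun _ h => convKernel_eq_zero S f g h

theorem hasCompactSupport_toLOne_convSlice [MeasurableSpace G] [BorelSpace G] (μ : Measure G)
    [IsFiniteMeasureOnCompacts μ] :
    HasCompactSupport fun s => toLOne 𝕜 μ (convSlice S f g s) :=
  HasCompactSupport.intro f.hasCompactSupport fun s hs => by
    have : convSlice S f g s = 0 := by
      ext t; exact convKernel_eq_zero S f g fun h => hs h.1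
    rw [this, map_zero]

end ConvSlice

section ConvSliceLOne

variable {𝕜 : Type u} [RCLike 𝕜]
  {A : Type*} [NonUnitalNormedRing A] [NormedSpace 𝕜 A] [NormedSpace ℝ A] [IsScalarTower ℝ 𝕜 A]
  [IsScalarTower 𝕜 A A] [SMulCommClass 𝕜 A A] [CompleteSpace A]
  {G : Type*} [Group G] [TopologicalSpace G] [IsTopologicalGroup G] [LocallyCompactSpace G]
  [T2Space G] [MeasurableSpace G] [BorelSpace G] (μ : Measure G) [μ.IsHaarMeasure]
  (S : DynSystem 𝕜 A G) (f g : C_c(G, A))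

theorem continuous_toLOne_convSlice : Continuous fun s => toLOne 𝕜 μ (convSlice S f g s) := by
  refine continuous_iff_continuousAt.2 fun s => ?_
  rw [ContinuousAt, tendsto_iff_norm_sub_tendsto_zero]
  simp only [← map_sub, norm_toLOne]
  exact tendsto_integral_norm_sub_of_continuous μ (F := fun s => convSlice S f g s)
    ((continuous_convKernel S f g).comp continuous_swap)
    (f.hasCompactSupport.isCompact.mul g.hasCompactSupport.isCompact)
    (.of_forall fun r t ht => convKernel_eq_zero S f g fun h => ht h.2)

theorem integral_toLOne_convSlice :
    ∫ s, toLOne 𝕜 μ (convSlice S f g s) ∂μ = toLOne 𝕜 μ (twistedConv S μ f g) := by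
  refine Lp.ext (Lp.ae_eq_of_forall_setIntegral_eq _ _ one_ne_zero ENNReal.one_ne_top
    (fun E _ _ => (L1.integrable_coeFn _).integrableOn)
    (fun E _ _ => (L1.integrable_coeFn _).integrableOn) fun E _ _ => ?_)
  let L : Lp A 1 μ →L[ℝ] A := L1.integralCLM.comp (LpToLpRestrictCLM G A ℝ μ 1 E)
  have hL : ∀ F, L F = ∫ t in E, F t ∂μ := fun F =>
    (L1.integral_eq _).symm.trans <| (L1.integral_eq_integral _).trans <|
      integral_congr_ae (LpToLpRestrictCLM_coeFn ℝ E F)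
  have hLcc : ∀ h : C_c(G, A), L (toLOne 𝕜 μ h) = ∫ t in E, h t ∂μ := fun h =>
    (hL _).trans (integral_congr_ae (ae_restrict_of_ae (coeFn_toLOne 𝕜 μ h)))
  rw [← hL, ← hL, ← ContinuousLinearMap.integral_comp_comm L
    ((continuous_toLOne_convSlice μ S f g).integrable_of_hasCompactSupport
      (hasCompactSupport_toLOne_convSlice S f g μ))]
  simp only [hLcc]
  exact integral_integral_swap_of_hasCompactSupport (f := fun s t => convKernel S f g t s)
    ((continuous_convKernel S f g).comp continuous_swap) (hasCompactSupport_convKernel_swap S f g)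

end ConvSliceLOne

/-! ## Comparison of the crossed product with `L¹` -/

namespace UniformlyBoundedClass

section Bounds

variable {𝕜 : Type u} [RCLike 𝕜] {A : Type*} [NonUnitalNormedRing A] [NormedSpace 𝕜 A]
  {G : Type*} [Group G] [TopologicalSpace G] {S : DynSystem 𝕜 A G}
  (R : UniformlyBoundedClass.{u, v} S)

theorem exists_norm_π_le : ∃ C : ℝ, 0 ≤ C ∧ ∀ ρ ∈ R.carrier, ‖ρ.2.π‖ ≤ C := by
  obtain ⟨C, _, hC, -, -, hb⟩ := R.bounded
  exact ⟨C, hC, fun ρ hρ => (hb ρ hρ).1⟩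

theorem norm_U_le_nu {ρ : Σ X : BanachSpace.{u, v} 𝕜, CovRep S X} (hρ : ρ ∈ R.carrier) (r : G) :
    ‖ρ.2.U r‖ ≤ R.nu r := by
  obtain ⟨_, ν, -, -, -, hb⟩ := R.bounded
  exact le_ciSup (f := fun ρ : R.carrier => ‖ρ.1.2.U r‖)
    ⟨ν r, Set.forall_mem_range.2 fun ρ => (hb ρ ρ.2).2 r⟩ ⟨ρ, hρ⟩

theorem nu_nonneg (r : G) : 0 ≤ R.nu r :=
  Real.iSup_nonneg fun _ => norm_nonneg _

end Bounds

variable {𝕜 : Type u} [RCLike 𝕜]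
  {A : Type*} [NonUnitalNormedRing A] [NormedSpace 𝕜 A] [NormedSpace ℝ A] [IsScalarTower ℝ 𝕜 A]
  [IsScalarTower 𝕜 A A] [SMulCommClass 𝕜 A A] [CompleteSpace A]
  {G : Type*} [Group G] [TopologicalSpace G] [IsTopologicalGroup G] [LocallyCompactSpace G]
  [T2Space G] [MeasurableSpace G] [BorelSpace G]
  {S : DynSystem 𝕜 A G} (R : UniformlyBoundedClass.{u, v} S) (μ : Measure G) [μ.IsHaarMeasure]

theorem sigma_le_of_forall {f : C_c(G, A)} {c : ℝ}
    (h : ∀ ρ ∈ R.carrier, ‖ρ.2.integrated μ f‖ ≤ c) : R.sigma μ f ≤ c :=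
  ciSup_le fun ρ => h _ ρ.2

theorem exists_sigma_le {D : ℝ} (hν : ∀ r, R.nu r ≤ D) :
    ∃ K : ℝ, ∀ f : C_c(G, A), R.sigma μ f ≤ K * ∫ s, ‖f s‖ ∂μ := by
  obtain ⟨C, hC, hb⟩ := R.exists_norm_π_le
  exact ⟨C * D, fun f => R.sigma_le_of_forall μ fun ρ hρ =>
    ρ.2.norm_integrated_le μ hC ((R.nu_nonneg 1).trans (hν 1)) (hb ρ hρ)
      (fun r => (R.norm_U_le_nu hρ r).trans (hν r)) f⟩

theorem exists_sigma_leftMul_le : ∃ C : ℝ, 0 ≤ C ∧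
    ∀ a (f : C_c(G, A)), R.sigma μ (leftMul a f) ≤ C * ‖a‖ * R.sigma μ f := by
  obtain ⟨C, hC, hb⟩ := R.exists_norm_π_le
  refine ⟨C, hC, fun a f => R.sigma_le_of_forall μ fun ρ hρ => ?_⟩
  rw [CovRep.integrated_leftMul]
  exact (norm_mul_le _ _).trans (mul_le_mul (ρ.2.π.le_of_opNorm_le (hb ρ hρ) a)
    (R.norm_integrated_le_sigma μ f ⟨ρ, hρ⟩) (norm_nonneg _) (by positivity))

theorem sigma_translate_le (r : G) (f : C_c(G, A)) :
    R.sigma μ (translate S r f) ≤ R.nu r * R.sigma μ f := by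
  refine R.sigma_le_of_forall μ fun ρ hρ => ?_
  rw [CovRep.integrated_translate]
  exact (norm_mul_le _ _).trans (mul_le_mul (R.norm_U_le_nu hρ r)
    (R.norm_integrated_le_sigma μ f ⟨ρ, hρ⟩) (norm_nonneg _) (R.nu_nonneg r))

variable {R μ} in
theorem tendsto_toCc (h₁ : ∃ K : ℝ, ∀ f : C_c(G, A), R.sigma μ f ≤ K * ∫ s, ‖f s‖ ∂μ)
    {ι : Type*} {l : Filter ι} {F : ι → C_c(G, A)} {f : C_c(G, A)}
    (h : Tendsto (fun i => ∫ s, ‖(F i - f) s‖ ∂μ) l (𝓝 0)) :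
    Tendsto (fun i => toCc R μ (F i)) l (𝓝 (toCc R μ f)) := by
  obtain ⟨K, hK⟩ := h₁
  rw [tendsto_iff_norm_sub_tendsto_zero]
  refine squeeze_zero (fun _ => norm_nonneg _) (fun i => hK (F i - f)) ?_
  simpa using h.const_mul K

theorem exists_approxLeftIdentity
    (h₁ : ∃ K : ℝ, ∀ f : C_c(G, A), R.sigma μ f ≤ K * ∫ s, ‖f s‖ ∂μ)
    (hA : HasBoundedApproxLeftIdentity A) :
    ∃ (l : Filter (CcAlgebra μ R)) (M : ℝ), l.NeBot ∧ (∀ᶠ e in l, ‖e‖ ≤ M) ∧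
      ∀ f, Tendsto (fun e => e * f) l (𝓝 f) := by
  obtain ⟨l, hl, ⟨M, hM⟩, hlim⟩ := hA
  have ⟨K, hK⟩ := h₁
  refine ⟨(deltaFilter μ ×ˢ l).map fun p => toCc R μ (bump p.1 1 p.2), |K| * M, inferInstance,
    ?_, fun f => ?_⟩
  · rw [eventually_map]
    filter_upwards [(eventually_deltaFilter μ univ_mem).prod_inl l, hM.prod_inr _] with p hp hpM
    refine (hK (bump p.1 1 p.2)).trans ?_
    rw [integral_norm_bump μ hp]
    exact mul_le_mul (le_abs_self K) hpM (norm_nonneg _) (abs_nonneg K)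
  · rw [tendsto_map'_iff]
    exact tendsto_toCc (F := fun p : C_c(G, ℝ) × A => twistedConv S μ (bump p.1 1 p.2) f) h₁
      (tendsto_bump_one_conv S μ hM hlim f)

/-- `q^𝓡` as a linear map. -/
def qₗ : C_c(G, A) →ₗ[𝕜] R.CrossedProduct μ where
  toFun := R.q μ
  map_add' f g := map_add (CrossedProduct.incl R μ) (toCc R μ f) (toCc R μ g)
  map_smul' c f := map_smul (CrossedProduct.incl R μ) c (toCc R μ f)

theorem qₗ_apply (f : C_c(G, A)) : R.qₗ μ f = R.q μ f := rfl

variable {R μ} in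
theorem q_eq_q {f g : C_c(G, A)} (h : ∀ ρ ∈ R.carrier, ρ.2.integrated μ f = ρ.2.integrated μ g) :
    R.q μ f = R.q μ g := by
  rw [← qₗ_apply, ← qₗ_apply, ← sub_eq_zero, ← map_sub, qₗ_apply, ← norm_le_zero_iff, norm_q]
  refine R.sigma_le_of_forall μ fun ρ hρ => ?_
  rw [sub_eq_add_neg, ← neg_one_smul 𝕜 g, CovRep.integrated_add, CovRep.integrated_smul, h ρ hρ,
    neg_one_smul, add_neg_cancel, norm_zero]

variable {R μ} in
@[elab_as_elim]
theorem induction_q {p : R.CrossedProduct μ → Prop} (c : R.CrossedProduct μ)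
    (hp : IsClosed {c | p c}) (h : ∀ f : C_c(G, A), p (R.q μ f)) : p c :=
  CrossedProduct.induction R μ c hp h

variable [μ.Regular]

variable {R μ} in
theorem integral_apply_q_convSlice
    (h₁ : ∃ K : ℝ, ∀ f : C_c(G, A), R.sigma μ f ≤ K * ∫ s, ‖f s‖ ∂μ)
    {X : Type*} [NormedAddCommGroup X] [NormedSpace 𝕜 X] [NormedSpace ℝ X] [CompleteSpace X]
    (Λ : R.CrossedProduct μ →L[𝕜] X) (f g : C_c(G, A)) :
    ∫ s, Λ (R.q μ (convSlice S f g s)) ∂μ = Λ (R.q μ (twistedConv S μ f g)) := by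
  let Q : Lp A 1 μ →L[𝕜] R.CrossedProduct μ := (R.qₗ μ).extendOfNorm (toLOne 𝕜 μ)
  have hQ : ∀ f, Q (toLOne 𝕜 μ f) = R.q μ f :=
    LinearMap.extendOfNorm_eq (denseRange_toLOne 𝕜 μ)
      (h₁.imp fun K hK f => by simpa only [norm_toLOne, qₗ_apply, norm_q] using hK f)
  simp only [← hQ, ← integral_toLOne_convSlice]
  exact (Λ.comp Q).integral_comp_comm
    ((continuous_toLOne_convSlice μ S f g).integrable_of_hasCompactSupport
      (hasCompactSupport_toLOne_convSlice S f g μ))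

variable (h₁ : ∃ K : ℝ, ∀ f : C_c(G, A), R.sigma μ f ≤ K * ∫ s, ‖f s‖ ∂μ)
  (h₂ : ∃ K : ℝ, ∀ f : C_c(G, A), ∫ s, ‖f s‖ ∂μ ≤ K * R.sigma μ f)

/-- The isomorphism of `L¹(G, A)` with the crossed product that extends `q^𝓡`, when `σ^𝓡` is
equivalent to the norm of `L¹`. -/
def lOneEquiv : Lp A 1 μ ≃L[𝕜] R.CrossedProduct μ :=
  (LinearEquiv.refl 𝕜 C_c(G, A)).extend (toLOne 𝕜 μ) (R.qₗ μ) (denseRange_toLOne 𝕜 μ)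
    (h₁.imp fun K hK f => by simpa [norm_toLOne, qₗ_apply, norm_q] using hK f)
    (R.denseRange_q μ)
    (h₂.imp fun K hK f => by simpa [norm_toLOne, qₗ_apply, norm_q] using hK f)

theorem lOneEquiv_toLOne (f : C_c(G, A)) : R.lOneEquiv μ h₁ h₂ (toLOne 𝕜 μ f) = R.q μ f :=
  LinearEquiv.extend_eq _ _ _ _ _ _ _ f

end UniformlyBoundedClass

/-! ## Representations of left centralizers -/

section Disintegration

section Centralizers

variable {𝕜 : Type*} [RCLike 𝕜] {X : Type*} [NormedAddCommGroup X] [NormedSpace 𝕜 X]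

theorem exists_operator_of_left_centralizer [CompleteSpace X] {B : Type*}
    [NonUnitalSeminormedRing B] [NormedSpace 𝕜 B] (T : B →L[𝕜] X →L[𝕜] X)
    (T_mul : ∀ a b, T (a * b) = T a * T b) (hT : NonDegenerate fun b => T b)
    {l : Filter B} [l.NeBot] {M : ℝ} (hM : ∀ᶠ e in l, ‖e‖ ≤ M)
    (hl : ∀ b : B, Tendsto (fun e => e * b) l (𝓝 b)) (L : B →L[𝕜] B)
    (hL : ∀ b c, L (b * c) = L b * c) :
    ∃ V : X →L[𝕜] X, (∀ b x, V (T b x) = T (L b) x) ∧ ‖V‖ ≤ ‖T‖ * (‖L‖ * M) := by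
  have key : ∀ b x, Tendsto (fun e => T (L e) (T b x)) l (𝓝 (T (L b) x)) := fun b x => by
    have hc : Continuous fun b => T (L b) x := by fun_prop
    simpa [Function.comp_def, T_mul, hL] using (hc.tendsto b).comp (hl b)
  have hbound : ∀ᶠ e in l, ‖T (L e)‖ ≤ ‖T‖ * (‖L‖ * M) := hM.mono fun e he =>
    (T.le_opNorm _).trans (by gcongr; exact (L.le_opNorm _).trans (by gcongr))
  obtain ⟨V, hV, hVK⟩ := exists_strong_limit_of_dense_span hbound hT
    (by rintro _ ⟨b, x, rfl⟩; exact ⟨_, key b x⟩)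
  exact ⟨V, fun b x => tendsto_nhds_unique (hV _) (key b x), hVK⟩

theorem NonDegenerate.of_forall_mem_closure {B B' : Type*} {τ : B → X →L[𝕜] X}
    {τ' : B' → X →L[𝕜] X} (hτ : NonDegenerate τ)
    (h : ∀ b x, τ b x ∈ closure (Submodule.span 𝕜 {y : X | ∃ b x, y = τ' b x} : Set X)) :
    NonDegenerate τ' := by
  have hle : Submodule.span 𝕜 {y : X | ∃ b x, y = τ b x}
      ≤ (Submodule.span 𝕜 {y : X | ∃ b x, y = τ' b x}).topologicalClosure := by
    rw [Submodule.span_le]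
    rintro _ ⟨b, x, rfl⟩
    exact h b x
  exact dense_closure.1 (hτ.mono hle)

end Centralizers

section LeftMul

variable {𝕜 : Type*} [RCLike 𝕜] {A : Type*} [NonUnitalNormedRing A] [NormedSpace 𝕜 A]
  [IsScalarTower 𝕜 A A] [SMulCommClass 𝕜 A A] {G : Type*} [TopologicalSpace G]

variable (𝕜 A G) in
/-- The action `leftMul` of `A` on `C_c(G, A)`, as a bilinear map. -/
def leftMulₗ : A →ₗ[𝕜] C_c(G, A) →ₗ[𝕜] C_c(G, A) :=
  LinearMap.mk₂ 𝕜 leftMul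
    (fun a b f => by ext t; simp [leftMul_apply, add_mul])
    (fun c a f => by ext t; simp [leftMul_apply, smul_mul_assoc])
    (fun a f g => by ext t; simp [leftMul_apply, mul_add])
    (fun c a f => by ext t; simp [leftMul_apply, mul_smul_comm])

end LeftMul

variable {𝕜 : Type u} [RCLike 𝕜]
  {A : Type*} [NonUnitalNormedRing A] [NormedSpace 𝕜 A] [NormedSpace ℝ A] [IsScalarTower ℝ 𝕜 A]
  [IsScalarTower 𝕜 A A] [SMulCommClass 𝕜 A A] [CompleteSpace A]
  {G : Type*} [Group G] [TopologicalSpace G] [IsTopologicalGroup G] [LocallyCompactSpace G]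
  [T2Space G] [MeasurableSpace G] [BorelSpace G]
  {S : DynSystem 𝕜 A G} {R : UniformlyBoundedClass.{u, v} S} {μ : Measure G} [μ.IsHaarMeasure]

/-! ## Disintegration of the representations of the crossed product -/

namespace CrossedRep

variable {X : BanachSpace.{u, w} 𝕜} (τ : CrossedRep μ R X)

theorem ext_of_q {τ τ' : CrossedRep μ R X} (h : ∀ f, τ.T (R.q μ f) = τ'.T (R.q μ f)) :
    τ = τ' := by
  have hT : τ.T = τ'.T := ContinuousLinearMap.ext fun c =>
    UniformlyBoundedClass.induction_q c (isClosed_eq (by fun_prop) (by fun_prop)) h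
  cases τ
  congr

variable {τ} in
theorem nonDegenerate_q (hτ : τ.IsNonDegenerate) : NonDegenerate fun f => τ.T (R.q μ f) :=
  NonDegenerate.of_forall_mem_closure hτ fun c x => UniformlyBoundedClass.induction_q c
    (isClosed_closure.preimage (by fun_prop : Continuous fun c => τ.T c x))
    fun f => subset_closure (Submodule.subset_span ⟨f, x, rfl⟩)

variable {τ} in
theorem clm_ext_of_q {Y : Type*} [NormedAddCommGroup Y] [NormedSpace 𝕜 Y]
    (hτ : τ.IsNonDegenerate) {V W : X →L[𝕜] Y}
    (h : ∀ f x, V (τ.T (R.q μ f) x) = W (τ.T (R.q μ f) x)) : V = W :=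
  ContinuousLinearMap.ext_on (nonDegenerate_q hτ) (by rintro _ ⟨f, x, rfl⟩; exact h f x)

theorem tendsto_T_q (h₁ : ∃ K : ℝ, ∀ f : C_c(G, A), R.sigma μ f ≤ K * ∫ s, ‖f s‖ ∂μ)
    {ι : Type*} {l : Filter ι} {F : ι → C_c(G, A)} {f : C_c(G, A)}
    (h : Tendsto (fun i => ∫ s, ‖(F i - f) s‖ ∂μ) l (𝓝 0)) (x : X) :
    Tendsto (fun i => τ.T (R.q μ (F i)) x) l (𝓝 (τ.T (R.q μ f) x)) := by
  have hc : Continuous fun f => τ.T (UniformlyBoundedClass.CrossedProduct.incl R μ f) x := by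
    fun_prop
  exact (hc.tendsto _).comp (UniformlyBoundedClass.tendsto_toCc h₁ h)

theorem T_q_add (f g : C_c(G, A)) : τ.T (R.q μ (f + g)) = τ.T (R.q μ f) + τ.T (R.q μ g) := by
  simp only [← R.qₗ_apply, map_add]

theorem T_q_smul (c : 𝕜) (f : C_c(G, A)) : τ.T (R.q μ (c • f)) = c • τ.T (R.q μ f) := by
  simp only [← R.qₗ_apply, map_smul]

variable {τ} in
theorem exists_operator (hA : HasBoundedApproxLeftIdentity A)
    (h₁ : ∃ K : ℝ, ∀ f : C_c(G, A), R.sigma μ f ≤ K * ∫ s, ‖f s‖ ∂μ) (hτ : τ.IsNonDegenerate) :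
    ∃ C : ℝ, 0 ≤ C ∧ ∀ (L : C_c(G, A) →ₗ[𝕜] C_c(G, A)) (c : ℝ), 0 ≤ c →
      (∀ f, R.sigma μ (L f) ≤ c * R.sigma μ f) →
      (∀ f g, L (twistedConv S μ f g) = twistedConv S μ (L f) g) →
      ∃ V : X →L[𝕜] X, (∀ f x, V (τ.T (R.q μ f) x) = τ.T (R.q μ (L f)) x) ∧ ‖V‖ ≤ C * c := by
  obtain ⟨l, M, hl, hM, hlim⟩ := R.exists_approxLeftIdentity μ h₁ hA
  have hM0 : 0 ≤ M := let ⟨e, he⟩ := hM.exists; (norm_nonneg e).trans he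
  let T : UniformlyBoundedClass.CcAlgebra μ R →L[𝕜] X →L[𝕜] X :=
    τ.T.comp (UniformlyBoundedClass.CrossedProduct.incl R μ)
  have T_mul : ∀ f g, T (f * g) = T f * T g := fun f g =>
    (congrArg τ.T (R.q_conv μ f g)).trans (τ.T_mul _ _)
  refine ⟨‖T‖ * M, by positivity, fun L c hc hLc hL => ?_⟩
  let L' : UniformlyBoundedClass.CcAlgebra μ R →L[𝕜] UniformlyBoundedClass.CcAlgebra μ R :=
    LinearMap.mkContinuous L c hLc
  obtain ⟨V, hV, hVn⟩ :=
    exists_operator_of_left_centralizer T T_mul (nonDegenerate_q hτ) hM hlim L' hL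
  refine ⟨V, hV, hVn.trans ?_⟩
  calc ‖T‖ * (‖L'‖ * M) ≤ ‖T‖ * (c * M) := by
        gcongr; exact LinearMap.mkContinuous_norm_le _ hc _
    _ = ‖T‖ * M * c := by ring

variable {τ} in
theorem exists_π (hA : HasBoundedApproxLeftIdentity A)
    (h₁ : ∃ K : ℝ, ∀ f : C_c(G, A), R.sigma μ f ≤ K * ∫ s, ‖f s‖ ∂μ) (hτ : τ.IsNonDegenerate) :
    ∃ π : A →L[𝕜] X →L[𝕜] X,
      ∀ a f x, π a (τ.T (R.q μ f) x) = τ.T (R.q μ (leftMul a f)) x := by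
  obtain ⟨C, -, hop⟩ := exists_operator hA h₁ hτ
  obtain ⟨C', hC', hleft⟩ := R.exists_sigma_leftMul_le μ
  choose π hπ hπn using fun a : A => hop (leftMulₗ 𝕜 A G a) (C' * ‖a‖) (by positivity) (hleft a)
    (leftMul_conv S μ a)
  refine ⟨LinearMap.mkContinuous ⟨⟨π, fun a b => ?_⟩, fun c a => ?_⟩ (C * C') fun a =>
    (hπn a).trans_eq (mul_assoc C C' ‖a‖).symm, hπ⟩
  · exact clm_ext_of_q hτ fun f x => by simp [hπ, T_q_add]
  · exact clm_ext_of_q hτ fun f x => by simp [hπ, T_q_smul]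

variable {τ} in
theorem exists_U (hA : HasBoundedApproxLeftIdentity A)
    {D : ℝ} (hν : ∀ r, R.nu r ≤ D) (hτ : τ.IsNonDegenerate) :
    ∃ U : G →* (X →L[𝕜] X), (∃ C : ℝ, ∀ r, ‖U r‖ ≤ C) ∧
      ∀ r f x, U r (τ.T (R.q μ f) x) = τ.T (R.q μ (translate S r f)) x := by
  obtain ⟨C, hC, hop⟩ := exists_operator hA (R.exists_sigma_le μ hν) hτ
  choose U hU hUn using fun r : G => hop
    { toFun := translate S r
      map_add' := fun f g => by ext t; simp [translate_apply]
      map_smul' := fun c f => by ext t; simp [translate_apply] }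
    (R.nu r) (R.nu_nonneg r) (R.sigma_translate_le μ r) (translate_conv S μ r)
  refine ⟨⟨⟨U, ?_⟩, fun r s => ?_⟩, ⟨C * D, fun r => (hUn r).trans ?_⟩, hU⟩
  · exact clm_ext_of_q hτ fun f x => by simp [hU, translate_one]
  · exact clm_ext_of_q hτ fun f x => by simp [hU, translate_translate]
  · exact mul_le_mul_of_nonneg_left (hν r) hC

end CrossedRep

/-- `(π, U)` disintegrates the representation `τ` of the crossed product: `A` and `G` act on the
vectors `τ(q^𝓡(f)) x` through their actions on `f`. -/
structure CovRep.Disintegrates {X : BanachSpace.{u, w} 𝕜} (ρ : CovRep S X)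
    (τ : CrossedRep μ R X) : Prop where
  π_apply : ∀ a f x, ρ.π a (τ.T (R.q μ f) x) = τ.T (R.q μ (leftMul a f)) x
  U_apply : ∀ r f x, ρ.U r (τ.T (R.q μ f) x) = τ.T (R.q μ (translate S r f)) x

namespace CrossedRep

variable {X : BanachSpace.{u, w} 𝕜} {τ : CrossedRep μ R X}

theorem exists_disintegrates (hA : HasBoundedApproxLeftIdentity A)
    {D : ℝ} (hν : ∀ r, R.nu r ≤ D) (hτ : τ.IsNonDegenerate) :
    ∃ ρ : CovRep S X, ρ.IsUniformlyBounded ∧ ρ.Disintegrates τ := by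
  have h₁ := R.exists_sigma_le μ hν
  obtain ⟨π, hπ⟩ := exists_π hA h₁ hτ
  obtain ⟨U, ⟨C, hUC⟩, hU⟩ := exists_U hA hν hτ
  let ρ : CovRep S X :=
    { π := π
      π_mul := fun a b => clm_ext_of_q hτ fun f x => by
        rw [mul_apply_eq_comp, hπ, hπ, hπ, leftMul_leftMul]
      U := U
      continuous_U := fun x => continuous_iff_continuousAt.2 fun r => by
        refine tendsto_apply_of_dense_span (F := U) (.of_forall hUC) (U r) (nonDegenerate_q hτ)
          ?_ x
        rintro _ ⟨f, y, rfl⟩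
        simp only [hU]
        exact τ.tendsto_T_q h₁ (tendsto_translate S μ f r) y
      covariant := fun s a => clm_ext_of_q hτ fun f x => by
        simp only [mul_apply_eq_comp, hπ, hU, leftMul_act] }
  exact ⟨ρ, ⟨C, hUC⟩, hπ, hU⟩

variable {ρ : CovRep S X}

theorem isNonDegenerate_of_disintegrates (hA : HasBoundedApproxLeftIdentity A)
    (h₁ : ∃ K : ℝ, ∀ f : C_c(G, A), R.sigma μ f ≤ K * ∫ s, ‖f s‖ ∂μ) (hτ : τ.IsNonDegenerate)
    (h : ρ.Disintegrates τ) : ρ.IsNonDegenerate := by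
  obtain ⟨l, hl, ⟨M, hM⟩, hlim⟩ := hA
  refine NonDegenerate.of_forall_mem_closure (nonDegenerate_q hτ) fun f x => ?_
  exact mem_closure_of_tendsto (τ.tendsto_T_q h₁ (tendsto_leftMul μ hM hlim f) x)
    (.of_forall fun u => Submodule.subset_span ⟨u, _, (h.π_apply u f x).symm⟩)

theorem integrated_of_disintegrates [μ.Regular]
    (h₁ : ∃ K : ℝ, ∀ f : C_c(G, A), R.sigma μ f ≤ K * ∫ s, ‖f s‖ ∂μ) (hτ : τ.IsNonDegenerate)
    (h : ρ.Disintegrates τ) (f : C_c(G, A)) : ρ.integrated μ f = τ.T (R.q μ f) := by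
  refine clm_ext_of_q hτ fun g x => ?_
  calc ρ.integrated μ f (τ.T (R.q μ g) x) = ∫ s, τ.T (R.q μ (convSlice S f g s)) x ∂μ := by
        simp only [CovRep.integrated_apply, h.U_apply, h.π_apply, convSlice]
    _ = τ.T (R.q μ (twistedConv S μ f g)) x :=
        UniformlyBoundedClass.integral_apply_q_convSlice h₁
          ((ContinuousLinearMap.apply 𝕜 X x).comp τ.T) f g
    _ = τ.T (R.q μ f) (τ.T (R.q μ g) x) := by rw [UniformlyBoundedClass.q_conv, τ.T_mul]; rfl

theorem exists_covRep [μ.Regular] (hA : HasBoundedApproxLeftIdentity A)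
    {D : ℝ} (hν : ∀ r, R.nu r ≤ D) (hτ : τ.IsNonDegenerate) :
    ∃ ρ : CovRep S X, ρ.IsNonDegenerate ∧ ρ.IsUniformlyBounded ∧
      ∀ f, ρ.integrated μ f = τ.T (R.q μ f) := by
  have h₁ := R.exists_sigma_le μ hν
  obtain ⟨ρ, hρ, h⟩ := exists_disintegrates hA hν hτ
  exact ⟨ρ, isNonDegenerate_of_disintegrates hA h₁ hτ h, hρ, integrated_of_disintegrates h₁ hτ h⟩

end CrossedRep

end Disintegration

section Integration

variable {𝕜 : Type u} [RCLike 𝕜]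
  {A : Type*} [NonUnitalNormedRing A] [NormedSpace 𝕜 A] [NormedSpace ℝ A] [IsScalarTower ℝ 𝕜 A]
  [IsScalarTower 𝕜 A A] [SMulCommClass 𝕜 A A] [CompleteSpace A]
  {G : Type*} [Group G] [TopologicalSpace G] [IsTopologicalGroup G] [LocallyCompactSpace G]
  [T2Space G] [MeasurableSpace G] [BorelSpace G]
  {S : DynSystem 𝕜 A G} {R : UniformlyBoundedClass.{u, v} S} {μ : Measure G} [μ.IsHaarMeasure]

/-! ## Integration of covariant representations -/

namespace CovRep

variable {X X' : BanachSpace.{u, w} 𝕜} {ρ : CovRep S X} {ρ' : CovRep S X'}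

theorem isRContinuous (h₂ : ∃ K : ℝ, ∀ f : C_c(G, A), ∫ s, ‖f s‖ ∂μ ≤ K * R.sigma μ f)
    (hρ : ρ.IsUniformlyBounded) : ρ.IsRContinuous μ R := by
  obtain ⟨K, hK⟩ := h₂
  obtain ⟨D, hD⟩ := hρ
  have hD0 : 0 ≤ D := (norm_nonneg _).trans (hD 1)
  refine ⟨‖ρ.π‖ * D * K, fun f => ?_⟩
  calc ‖ρ.integrated μ f‖ ≤ ‖ρ.π‖ * D * ∫ s, ‖f s‖ ∂μ :=
        ρ.norm_integrated_le μ (norm_nonneg ρ.π) hD0 le_rfl hD f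
    _ ≤ ‖ρ.π‖ * D * (K * R.sigma μ f) := by gcongr; exact hK f
    _ = _ := by ring

theorem isNonDegenerate_integration (h : ρ.IsRContinuous μ R) (hρ : ρ.IsNonDegenerate) :
    (ρ.integration h).IsNonDegenerate := by
  refine NonDegenerate.of_forall_mem_closure hρ fun a x => ?_
  have hlim := ρ.tendsto_integrated_bump μ 1 a x
  rw [U_one_apply] at hlim
  refine mem_closure_of_tendsto hlim (.of_forall fun φ => Submodule.subset_span
    ⟨R.q μ (bump φ 1 a), x, ?_⟩)
  rw [integration_q]

/-! ### Intertwining operators -/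

theorem Intertwines.integrated_apply_comm {Φ : X →L[𝕜] X'} (h : ρ.Intertwines ρ' Φ)
    (f : C_c(G, A)) (x : X) : ρ'.integrated μ f (Φ x) = Φ (ρ.integrated μ f x) := by
  have hU : ∀ s, ρ'.U s (Φ x) = Φ (ρ.U s x) := fun s => DFunLike.congr_fun (h.2 s) x
  have hπ : ∀ a y, ρ'.π a (Φ y) = Φ (ρ.π a y) := fun a => DFunLike.congr_fun (h.1 a)
  simp only [integrated_apply, hU, hπ]
  exact Φ.integral_comp_comm (ρ.integrable μ f x)

theorem intertwines_of_integrated (hA : HasBoundedApproxLeftIdentity A)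
    (hρ : ρ.IsNonDegenerate) (hρ' : ρ'.IsNonDegenerate) {Φ : X →L[𝕜] X'}
    (h : ∀ f x, ρ'.integrated μ f (Φ x) = Φ (ρ.integrated μ f x)) : ρ.Intertwines ρ' Φ := by
  have hπU : ∀ a s x, ρ'.π a (ρ'.U s (Φ x)) = Φ (ρ.π a (ρ.U s x)) := fun a s x => by
    refine tendsto_nhds_unique (ρ'.tendsto_integrated_bump μ s a (Φ x)) ?_
    simp only [h]
    exact (Φ.continuous.tendsto _).comp (ρ.tendsto_integrated_bump μ s a x)
  refine ⟨fun a => ?_, fun s => ?_⟩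
  · ext x
    simpa [U_one_apply] using hπU a 1 x
  · ext x
    obtain ⟨l, hl, ⟨M, hM⟩, hlim⟩ := hA
    have hlim' := ((ρ'.U s).continuous.tendsto _).comp
      (ρ'.tendsto_π_of_isNonDegenerate hρ' hM hlim (Φ x))
    have hlimΦ := (Φ.continuous.tendsto _).comp (((ρ.U s).continuous.tendsto _).comp
      (ρ.tendsto_π_of_isNonDegenerate hρ hM hlim x))
    refine tendsto_nhds_unique hlim' (hlimΦ.congr fun u => ?_)
    have := hπU (S.act s u) s x
    rw [covariant_apply, covariant_apply] at this
    exact this.symm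

theorem intertwines_integration_iff {h : ρ.IsRContinuous μ R} {h' : ρ'.IsRContinuous μ R}
    {Φ : X →L[𝕜] X'} : (ρ.integration h).Intertwines (ρ'.integration h') Φ ↔
      ∀ f x, ρ'.integrated μ f (Φ x) = Φ (ρ.integrated μ f x) := by
  refine ⟨fun hΦ f x => ?_, fun hΦ c => ?_⟩
  · simpa only [integration_q, ContinuousLinearMap.comp_apply] using
      DFunLike.congr_fun (hΦ (R.q μ f)) x
  · refine UniformlyBoundedClass.induction_q c (isClosed_eq (by fun_prop) (by fun_prop)) fun f => ?_
    ext x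
    simpa only [integration_q, ContinuousLinearMap.comp_apply] using hΦ f x

theorem intertwines_iff (hA : HasBoundedApproxLeftIdentity A)
    (hρ : ρ.IsNonDegenerate) (hρ' : ρ'.IsNonDegenerate) (h : ρ.IsRContinuous μ R)
    (h' : ρ'.IsRContinuous μ R) (Φ : X →L[𝕜] X') :
    ρ.Intertwines ρ' Φ ↔ (ρ.integration h).Intertwines (ρ'.integration h') Φ :=
  intertwines_integration_iff.symm.subst
    ⟨fun hΦ => hΦ.integrated_apply_comm, intertwines_of_integrated hA hρ hρ'⟩

theorem eq_of_integrated (hA : HasBoundedApproxLeftIdentity A) {ρ ρ' : CovRep S X}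
    (hρ : ρ.IsNonDegenerate) (hρ' : ρ'.IsNonDegenerate)
    (h : ∀ f, ρ.integrated μ f = ρ'.integrated μ f) : ρ = ρ' := by
  have hi : ρ.Intertwines ρ' (ContinuousLinearMap.id 𝕜 X) :=
    intertwines_of_integrated (μ := μ) hA hρ hρ' fun f x => by simp [h]
  have hπ : ρ.π = ρ'.π := ContinuousLinearMap.ext fun a => by simpa using (hi.1 a).symm
  have hU : ρ.U = ρ'.U := MonoidHom.ext fun s => by simpa using (hi.2 s).symm
  cases ρ
  congr

/-! ### Invariant subspaces -/

theorem IsInvariant.integrated_mem {Y : Submodule 𝕜 X} (hi : ρ.IsInvariant Y)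
    (hY : IsClosed (Y : Set X)) (f : C_c(G, A)) {y : X} (hy : y ∈ Y) :
    ρ.integrated μ f y ∈ Y := by
  have : CompleteSpace (Y.restrictScalars ℝ) := hY.completeSpace_coe
  let F : G → Y.restrictScalars ℝ := fun s => ⟨ρ.π (f s) (ρ.U s y), hi.1 _ _ (hi.2 s y hy)⟩
  have hFc : Continuous F :=
    (ρ.continuous_comp continuous_id f.continuous continuous_const).subtype_mk _
  have hFs : HasCompactSupport F := HasCompactSupport.intro f.hasCompactSupport fun s hs => by
    simp [F, eq_zero_of_notMem_tsupport f hs]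
  rw [integrated_apply]
  exact ((Y.restrictScalars ℝ).subtypeL.integral_comp_comm
    (hFc.integrable_of_hasCompactSupport hFs (μ := μ))).symm ▸ (∫ s, F s ∂μ).2

theorem isInvariant_of_integrated_mem (hA : HasBoundedApproxLeftIdentity A)
    (hρ : ρ.IsNonDegenerate) {Y : Submodule 𝕜 X} (hY : IsClosed (Y : Set X))
    (h : ∀ f, ∀ y ∈ Y, ρ.integrated μ f y ∈ Y) : ρ.IsInvariant Y := by
  have hπU : ∀ a s, ∀ y ∈ Y, ρ.π a (ρ.U s y) ∈ Y := fun a s y hy =>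
    hY.mem_of_tendsto (ρ.tendsto_integrated_bump μ s a y) (.of_forall fun φ => h _ y hy)
  refine ⟨fun a y hy => by simpa [U_one_apply] using hπU a 1 y hy, fun s y hy => ?_⟩
  obtain ⟨l, hl, ⟨M, hM⟩, hlim⟩ := hA
  refine hY.mem_of_tendsto (((ρ.U s).continuous.tendsto _).comp
    (ρ.tendsto_π_of_isNonDegenerate hρ hM hlim y)) (.of_forall fun u => ?_)
  have := hπU (S.act s u) s y hy
  rwa [covariant_apply] at this

theorem isInvariant_integration_iff {h : ρ.IsRContinuous μ R} {Y : Submodule 𝕜 X}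
    (hY : IsClosed (Y : Set X)) :
    (ρ.integration h).IsInvariant Y ↔ ∀ f, ∀ y ∈ Y, ρ.integrated μ f y ∈ Y := by
  refine ⟨fun hi f y hy => ?_, fun hi c y hy => ?_⟩
  · simpa only [integration_q] using hi (R.q μ f) y hy
  · refine UniformlyBoundedClass.induction_q c
      (hY.preimage (by fun_prop : Continuous fun c => (ρ.integration h).T c y)) fun f => ?_
    simpa only [integration_q] using hi f y hy

theorem isInvariant_iff (hA : HasBoundedApproxLeftIdentity A)
    (hρ : ρ.IsNonDegenerate) (h : ρ.IsRContinuous μ R) {Y : Submodule 𝕜 X}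
    (hY : IsClosed (Y : Set X)) : ρ.IsInvariant Y ↔ (ρ.integration h).IsInvariant Y :=
  (isInvariant_integration_iff hY).symm.subst
    ⟨fun hi f _ hy => hi.integrated_mem hY f hy, isInvariant_of_integrated_mem hA hρ hY⟩

end CovRep

/-! ### The bijection -/

theorem injOn_integrationMap (hA : HasBoundedApproxLeftIdentity A) :
    Set.InjOn (integrationMap.{u, v, w} μ R) {p | p.2.1.IsNonDegenerate} := by
  rintro ⟨X, ρ, h⟩ hρ ⟨X', ρ', h'⟩ hρ' heq
  obtain ⟨rfl : X = X', hT⟩ := Sigma.mk.inj_iff.1 heq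
  obtain rfl : ρ = ρ' := CovRep.eq_of_integrated (μ := μ) hA hρ hρ' fun f => by
    rw [← ρ.integration_q h, ← ρ'.integration_q h', eq_of_heq hT]
  rfl

theorem bijOn_integrationMap [μ.Regular] (hA : HasBoundedApproxLeftIdentity A)
    {D : ℝ} (hν : ∀ r, R.nu r ≤ D)
    (h₂ : ∃ K : ℝ, ∀ f : C_c(G, A), ∫ s, ‖f s‖ ∂μ ≤ K * R.sigma μ f)
    (𝒳 : Set (BanachSpace.{u, w} 𝕜)) :
    Set.BijOn (integrationMap μ R)
      {p | p.1 ∈ 𝒳 ∧ p.2.1.IsNonDegenerate ∧ p.2.1.IsUniformlyBounded}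
      {t | t.1 ∈ 𝒳 ∧ t.2.IsNonDegenerate} := by
  refine ⟨fun p hp => ⟨hp.1, CovRep.isNonDegenerate_integration p.2.2 hp.2.1⟩,
    (injOn_integrationMap hA).mono fun p hp => hp.2.1, ?_⟩
  rintro ⟨X, τ⟩ ⟨hX, hτ⟩
  obtain ⟨ρ, hρ, hρb, hρτ⟩ := CrossedRep.exists_covRep hA hν hτ
  have h := CovRep.isRContinuous h₂ hρb
  exact ⟨⟨X, ρ, h⟩, ⟨hX, hρ, hρb⟩, congrArg (Sigma.mk X) (CrossedRep.ext_of_q fun f =>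
    (ρ.integration_q h f).trans (hρτ f))⟩

end Integration

/-! ## Inversion and Haar measure -/

section Inversion

variable {G : Type*} [Group G] [TopologicalSpace G] [IsTopologicalGroup G] [LocallyCompactSpace G]

theorem modularFun_pos (r : G) : 0 < modularFun r :=
  inv_pos.2 (NNReal.coe_pos.2 (Measure.modularCharacterFun_pos r))

variable [T2Space G] [MeasurableSpace G] [BorelSpace G] (μ : Measure G) [μ.IsHaarMeasure]

theorem integral_modularFun_inv_mul {f : G → ℝ} (hf : Continuous f) (hs : HasCompactSupport f) :
    ∫ s, modularFun s⁻¹ * f s⁻¹ ∂μ = ∫ s, f s ∂μ := by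
  obtain ⟨⟨g, hg⟩, hgs : HasCompactSupport g, hgn, hg1⟩ :
    ∃ g : C(G, ℝ), HasCompactSupport g ∧ 0 ≤ g ∧ g 1 ≠ 0 := exists_continuous_nonneg_pos 1
  have hinv : ∀ h : G → ℝ, ∫ s, h s ∂μ.inv = ∫ s, h s⁻¹ ∂μ := fun h =>
    (Homeomorph.inv G).measurableEmbedding.integral_map h
  -- `μ` is left invariant and `μ.inv` is right invariant, hence each is a multiple of the other
  -- up to the density `1 / ∫ g (t⁻¹ s) ds⁻¹`, which `modularCharacter_mul_integral` evaluates.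
  rw [Measure.integral_isMulLeftInvariant_isMulRightInvariant_combo (μ := μ) (ν := μ.inv)
    hf hs hg hgs hgn hg1, hinv, ← integral_mul_const]
  have hpos : 0 < ∫ s, g s ∂μ :=
    hg.integral_pos_of_hasCompactSupport_nonneg_nonzero hgs hgn hg1
  refine integral_congr_ae (.of_forall fun s => ?_)
  simp only [hinv, inv_inv, ← modularCharacter_mul_integral μ hg hgs]
  rw [modularFun]
  field_simp

theorem integral_modularFun_inv_smul {E : Type*} [NormedAddCommGroup E] [NormedSpace ℝ E]
    [CompleteSpace E] {f : G → E} (hf : Continuous f) (hs : HasCompactSupport f) :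
    ∫ s, modularFun s⁻¹ • f s⁻¹ ∂μ = ∫ s, f s ∂μ := by
  rw [SeparatingDual.eq_iff_forall_dual_eq (R := ℝ)]
  intro L
  have hi : Integrable (fun s => modularFun s⁻¹ • f s⁻¹) μ :=
    Continuous.integrable_of_hasCompactSupport
      ((continuous_modularFun.comp continuous_inv).smul (hf.comp continuous_inv))
      (hs.comp_homeomorph (Homeomorph.inv G)).smul_left
  rw [← ContinuousLinearMap.integral_comp_comm L hi, ← ContinuousLinearMap.integral_comp_comm L
    (hf.integrable_of_hasCompactSupport hs)]
  simpa only [map_smul, smul_eq_mul, Function.comp_apply] using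
    integral_modularFun_inv_mul μ (L.continuous.comp hf) (hs.comp_left (map_zero L))

variable [μ.Regular]

theorem measure_inv_le_of_isOpen {W : Set G} (hW : IsOpen W) {c : ℝ}
    (hc : ∀ s ∈ W, modularFun s⁻¹ ≤ c) : μ W⁻¹ ≤ ENNReal.ofReal c * μ W := by
  rw [hW.inv.measure_eq_iSup_isCompact]
  refine iSup₂_le fun K hKW => iSup_le fun hK => ?_
  obtain ⟨f, hf1, hf0, hfc, hf⟩ := exists_continuous_one_zero_of_isCompact hK
    hW.inv.isClosed_compl (Set.disjoint_compl_right_iff_subset.2 hKW)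
  have hfinv : Integrable (fun s => modularFun s⁻¹ * f s⁻¹) μ :=
    Continuous.integrable_of_hasCompactSupport
      ((continuous_modularFun.comp continuous_inv).mul (f.continuous.comp continuous_inv))
      (HasCompactSupport.comp_homeomorph hfc (Homeomorph.inv G)).mul_left
  calc μ K = ∫⁻ s, K.indicator 1 s ∂μ := (lintegral_indicator_one hK.measurableSet).symm
    _ ≤ ∫⁻ s, ENNReal.ofReal (f s) ∂μ := lintegral_mono fun s => by
        by_cases hs : s ∈ K
        · simp [hs, hf1 hs]
        · simp [hs]
    _ = ENNReal.ofReal (∫ s, modularFun s⁻¹ * f s⁻¹ ∂μ) := by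
        rw [integral_modularFun_inv_mul μ f.continuous hfc, ofReal_integral_eq_lintegral_ofReal
          (f.continuous.integrable_of_hasCompactSupport hfc) (.of_forall fun s => (hf s).1)]
    _ = ∫⁻ s, ENNReal.ofReal (modularFun s⁻¹ * f s⁻¹) ∂μ :=
        ofReal_integral_eq_lintegral_ofReal hfinv
          (.of_forall fun s => mul_nonneg (modularFun_pos _).le (hf _).1)
    _ ≤ ∫⁻ s, W.indicator (fun _ => ENNReal.ofReal c) s ∂μ := lintegral_mono fun s => by
        by_cases hs : s ∈ W
        · rw [Set.indicator_of_mem hs]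
          exact ENNReal.ofReal_le_ofReal
            ((mul_le_of_le_one_right (modularFun_pos _).le (hf _).2).trans (hc s hs))
        · have : f s⁻¹ = 0 := hf0 fun h => hs (by simpa using h)
          simp [this]
    _ = ENNReal.ofReal c * μ W := lintegral_indicator_const hW.measurableSet _

theorem measure_inter_inv_eq_zero {N K : Set G} (hN : μ N = 0) (hK : IsCompact K) :
    μ (K ∩ N⁻¹) = 0 := by
  obtain ⟨Q, hQ, hKQ⟩ := exists_compact_superset hK.inv
  obtain ⟨c, hc⟩ := hQ.exists_bound_of_continuousOn
    ((continuous_modularFun (G := G)).comp continuous_inv).continuousOn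
  have key : ∀ ε : ENNReal, 0 < ε → μ (K ∩ N⁻¹) ≤ ENNReal.ofReal c * ε := fun ε hε => by
    obtain ⟨V, hNV, hV, hVε⟩ := N.exists_isOpen_lt_of_lt (μ := μ) ε (by simpa [hN] using hε)
    calc μ (K ∩ N⁻¹) ≤ μ (V ∩ interior Q)⁻¹ :=
          measure_mono fun s hs => ⟨hNV hs.2, hKQ (Set.inv_mem_inv.2 hs.1)⟩
      _ ≤ ENNReal.ofReal c * μ (V ∩ interior Q) :=
          measure_inv_le_of_isOpen μ (hV.inter isOpen_interior) fun s hs =>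
            (le_abs_self _).trans (hc s (interior_subset hs.2))
      _ ≤ ENNReal.ofReal c * ε := by
          gcongr
          exact (measure_mono Set.inter_subset_left).trans hVε.le
  have hlim : Tendsto (fun ε => ENNReal.ofReal c * ε) (𝓝[>] 0) (𝓝 0) := by
    simpa using ((ENNReal.continuous_const_mul ENNReal.ofReal_ne_top).tendsto 0).mono_left
      nhdsWithin_le_nhds
  exact le_antisymm (ge_of_tendsto hlim (eventually_nhdsWithin_of_forall key)) zero_le

theorem ae_inv_mul_notMem {N K : Set G} (hN : μ N = 0) (hK : IsCompact K) (s : G) :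
    ∀ᵐ r ∂μ, r ∈ K → r⁻¹ * s ∉ N := by
  have h : μ (s • (s⁻¹ • K ∩ N⁻¹)) = 0 := by
    rw [measure_smul, measure_inter_inv_eq_zero μ hN (hK.smul s⁻¹)]
  refine measure_mono_null (fun r hr => ?_) h
  obtain ⟨hrK, hrN⟩ : r ∈ K ∧ r⁻¹ * s ∈ N := by simpa using hr
  rw [Set.mem_smul_set_iff_inv_smul_mem]
  exact ⟨Set.smul_mem_smul_set hrK, by simpa using hrN⟩

end Inversion

/-! ## Series in `L¹` -/

section Series

variable {α E ι : Type*} [MeasurableSpace α] {μ : Measure α} [NormedAddCommGroup E]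
  [Countable ι] {F : ι → α → E}

theorem lintegral_tsum_enorm_ne_top (hF : ∀ i, Integrable (F i) μ)
    (hs : Summable fun i => ∫ a, ‖F i a‖ ∂μ) : ∫⁻ a, ∑' i, ‖F i a‖ₑ ∂μ ≠ ⊤ := by
  rw [lintegral_tsum fun i => (hF i).1.enorm]
  simp only [← fun i => ofReal_integral_norm_eq_lintegral_enorm (hF i)]
  exact hs.tsum_ofReal_ne_top

theorem ae_summable_norm (hF : ∀ i, Integrable (F i) μ)
    (hs : Summable fun i => ∫ a, ‖F i a‖ ∂μ) : ∀ᵐ a ∂μ, Summable fun i => ‖F i a‖ := by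
  filter_upwards [ae_lt_top' (AEMeasurable.tsum fun i => (hF i).1.enorm)
    (lintegral_tsum_enorm_ne_top hF hs)] with a ha
  simpa using ENNReal.summable_toReal ha.ne

theorem integrable_of_ae_hasSum (hF : ∀ i, Integrable (F i) μ)
    (hs : Summable fun i => ∫ a, ‖F i a‖ ∂μ) {g : α → E} (hg : ∀ᵐ a ∂μ, HasSum (F · a) (g a)) :
    Integrable g μ := by
  refine ⟨aestronglyMeasurable_of_tendsto_ae atTop
    (f := fun (t : Finset ι) a => ∑ i ∈ t, F i a)
    (fun t => Finset.aestronglyMeasurable_fun_sum t fun i _ => (hF i).1) hg, ?_⟩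
  refine (lintegral_mono_ae ?_).trans_lt (lintegral_tsum_enorm_ne_top hF hs).lt_top
  filter_upwards [hg] with a ha
  rw [← ha.tsum_eq]
  exact enorm_tsum_le_tsum_enorm

theorem hasSum_integral_of_ae_hasSum [NormedSpace ℝ E] (hF : ∀ i, Integrable (F i) μ)
    (hs : Summable fun i => ∫ a, ‖F i a‖ ∂μ) {g : α → E} (hg : ∀ᵐ a ∂μ, HasSum (F · a) (g a)) :
    HasSum (fun i => ∫ a, F i a ∂μ) (∫ a, g a ∂μ) := by
  have hg' : ∫ a, ∑' i, F i a ∂μ = ∫ a, g a ∂μ := integral_congr_ae (hg.mono fun _ h => h.tsum_eq)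
  exact hg' ▸ hasSum_integral_of_summable_integral_norm hF hs

end Series

section SeriesToLOne

variable (𝕜 : Type*) [RCLike 𝕜] {α E : Type*} [TopologicalSpace α] [MeasurableSpace α]
  [NormedAddCommGroup E] [NormedSpace 𝕜 E] (μ : Measure α)

theorem ae_hasSum_toLOne [OpensMeasurableSpace α] [IsFiniteMeasureOnCompacts μ] [CompleteSpace E]
    {ι : Type*} [Countable ι] {f : ι → C_c(α, E)} {F : Lp E 1 μ}
    (hf : HasSum (fun i => toLOne 𝕜 μ (f i)) F) (hs : Summable fun i => ∫ t, ‖f i t‖ ∂μ) :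
    ∀ᵐ t ∂μ, HasSum (fun i => f i t) (F t) := by
  obtain ⟨J, hJ, hlim⟩ := (tendstoInMeasure_of_tendsto_Lp hf).exists_seq_tendsto_ae'
  have hi : ∀ i, Integrable (f i) μ := fun i =>
    (f i).continuous.integrable_of_hasCompactSupport (f i).hasCompactSupport
  have hcoe : ∀ᵐ t ∂μ, ∀ n, (∑ i ∈ J n, toLOne 𝕜 μ (f i)) t = ∑ i ∈ J n, f i t :=
    ae_all_iff.2 fun n => by
      rw [← map_sum]
      filter_upwards [coeFn_toLOne 𝕜 μ (∑ i ∈ J n, f i)] with t ht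
      rw [ht, CompactlySupportedContinuousMap.coe_sum, Finset.sum_apply]
  filter_upwards [ae_summable_norm hi hs, hlim, hcoe] with t hst ht hc
  have hsum : HasSum (fun i => f i t) (∑' i, f i t) := hst.of_norm.hasSum
  simp only [hc] at ht
  rwa [tendsto_nhds_unique (hsum.comp hJ) ht] at hsum

theorem exists_hasSum_toLOne [BorelSpace α] [T2Space α] [LocallyCompactSpace α] [NormedSpace ℝ E]
    [CompleteSpace E] [μ.Regular] (F : Lp E 1 μ) :
    ∃ f : ℕ → C_c(α, E), HasSum (fun n => toLOne 𝕜 μ (f n)) F ∧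
      Summable fun n => ∫ t, ‖f n t‖ ∂μ := by
  obtain ⟨v, hv, hvs, -, hvb⟩ := controlled_sum_of_mem_closure
    (s := (LinearMap.range (toLOne 𝕜 μ : C_c(α, E) →ₗ[𝕜] Lp E 1 μ)).toAddSubgroup)
    (denseRange_toLOne 𝕜 μ F) (b := fun n => (1 / 2 : ℝ) ^ n) (fun n => by positivity)
  choose f hf using fun n => LinearMap.mem_range.1 (hvs n)
  have hsum : Summable fun n => ‖v n‖ := by
    rw [← summable_nat_add_iff 1]
    exact .of_nonneg_of_le (fun _ => norm_nonneg _) (fun n => (hvb (n + 1) n.succ_pos).le)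
      ((summable_nat_add_iff 1).2 summable_geometric_two)
  refine ⟨f, ?_, ?_⟩
  · simp only [hf]
    rw [hsum.of_norm.hasSum_iff_tendsto_nat]
    exact (tendsto_add_atTop_iff_nat 1).1 hv
  · simpa only [← norm_toLOne 𝕜, hf] using hsum

end SeriesToLOne

/-! ## Twisted convolution on `L¹(G, A)` -/

section TwistedConvLOne

theorem hasSum_mul_of_summable_norm {ι ι' B : Type*} [NonUnitalNormedRing B] [CompleteSpace B]
    {f : ι → B} {g : ι' → B} {a b : B} (hf : HasSum f a) (hf' : Summable fun n => ‖f n‖)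
    (hg : HasSum g b) (hg' : Summable fun n => ‖g n‖) :
    HasSum (fun p : ι × ι' => f p.1 * g p.2) (a * b) :=
  hf.mul hg <| .of_norm_bounded (hf'.mul_of_nonneg hg' (fun _ => norm_nonneg _)
    fun _ => norm_nonneg _) fun _ => norm_mul_le _ _

section ConvKernelSeries

variable {𝕜 : Type u} [RCLike 𝕜] {A : Type*} [NonUnitalNormedRing A] [NormedSpace 𝕜 A]
  [CompleteSpace A] {G : Type*} [Group G] [TopologicalSpace G] [IsTopologicalGroup G]
  [LocallyCompactSpace G] [T2Space G] [MeasurableSpace G] [BorelSpace G] {S : DynSystem 𝕜 A G}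
  (μ : Measure G) [μ.IsHaarMeasure] [μ.Regular] {K : ℝ} (hK : ∀ r a, ‖S.act r a‖ ≤ K * ‖a‖)
  {F H : Lp A 1 μ} {f h : ℕ → C_c(G, A)}
  (hf : HasSum (fun n => toLOne 𝕜 μ (f n)) F) (hfs : Summable fun n => ∫ t, ‖f n t‖ ∂μ)
  (hh : HasSum (fun n => toLOne 𝕜 μ (h n)) H) (hhs : Summable fun n => ∫ t, ‖h n t‖ ∂μ)

include hK hf hfs hh hhs in
theorem ae_hasSum_convKernel (s : G) :
    ∀ᵐ r ∂μ, HasSum (fun p : ℕ × ℕ => convKernel S (f p.1) (h p.2) s r)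
      (F r * S.act r (H (r⁻¹ * s))) := by
  have hi : ∀ f : C_c(G, A), Integrable f μ := fun f =>
    f.continuous.integrable_of_hasCompactSupport f.hasCompactSupport
  have hF := ae_hasSum_toLOne 𝕜 μ hf hfs
  have hH := (ae_hasSum_toLOne 𝕜 μ hh hhs).and (ae_summable_norm (fun n => hi (h n)) hhs)
  -- The bad points for `h` form a null set, whose inverse is in general only locally null; this is
  -- enough, since off the σ-compact union of the supports of the `f n` all terms vanish.
  have hH' := ae_all_iff.2 fun n =>
    ae_inv_mul_notMem μ hH (f n).hasCompactSupport.isCompact s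
  filter_upwards [hF, ae_summable_norm (fun n => hi (f n)) hfs, hH'] with r hFr hFr' hr
  by_cases hex : ∃ n, r ∈ tsupport (f n)
  · obtain ⟨n, hn⟩ := hex
    obtain ⟨hHr, hHr'⟩ : HasSum (fun n => h n (r⁻¹ * s)) (H (r⁻¹ * s)) ∧
        Summable fun n => ‖h n (r⁻¹ * s)‖ := not_not.1 (hr n hn)
    have hact : Summable fun m => ‖S.act r (h m (r⁻¹ * s))‖ :=
      .of_nonneg_of_le (fun _ => norm_nonneg _) (fun m => hK r _) (hHr'.mul_left K)
    exact hasSum_mul_of_summable_norm (f := fun n => f n r)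
      (g := fun n => S.act r (h n (r⁻¹ * s))) hFr hFr' (hHr.mapL (S.act r)) hact
  · have h0 : ∀ n, f n r = 0 := fun n =>
      image_eq_zero_of_notMem_tsupport fun hn => hex ⟨n, hn⟩
    have hF0 : F r = 0 := hFr.unique (by simp [h0])
    simp [convKernel, h0, hF0, hasSum_zero]

end ConvKernelSeries

variable {𝕜 : Type u} [RCLike 𝕜]
  {A : Type*} [NonUnitalNormedRing A] [NormedSpace 𝕜 A] [NormedSpace ℝ A] [IsScalarTower ℝ 𝕜 A]
  [IsScalarTower 𝕜 A A] [SMulCommClass 𝕜 A A] [CompleteSpace A]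
  {G : Type*} [Group G] [TopologicalSpace G] [IsTopologicalGroup G] [LocallyCompactSpace G]
  [T2Space G] [MeasurableSpace G] [BorelSpace G]
  {S : DynSystem 𝕜 A G} {R : UniformlyBoundedClass.{u, v} S} (μ : Measure G) [μ.IsHaarMeasure]

/-- Translation by `r` acts on the functions `bump φ 1 a`, of `L¹`-norm `‖a‖`, through `α_r`, so
that a bound for it in the norm `σ^𝓡` bounds the action. -/
theorem exists_norm_act_le {D : ℝ} (hν : ∀ r, R.nu r ≤ D)
    (h₂ : ∃ K : ℝ, ∀ f : C_c(G, A), ∫ s, ‖f s‖ ∂μ ≤ K * R.sigma μ f) :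
    ∃ K : ℝ, ∀ r a, ‖S.act r a‖ ≤ K * ‖a‖ := by
  obtain ⟨K₁, hK₁⟩ := R.exists_sigma_le μ hν
  obtain ⟨K₂, hK₂⟩ := h₂
  obtain ⟨φ, hφ⟩ := nonempty_probDensities μ (univ_mem (f := 𝓝 (1 : G)))
  have hD : 0 ≤ D := (R.nu_nonneg 1).trans (hν 1)
  refine ⟨|K₂| * (D * K₁), fun r a => ?_⟩
  calc ‖S.act r a‖ = ∫ t, ‖translate S r (bump φ 1 a) t‖ ∂μ := by
        rw [translate_bump, integral_norm_bump μ hφ]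
    _ ≤ K₂ * R.sigma μ (translate S r (bump φ 1 a)) := hK₂ _
    _ ≤ |K₂| * (R.nu r * R.sigma μ (bump φ 1 a)) :=
        mul_le_mul (le_abs_self _) (R.sigma_translate_le μ r _) (R.sigma_nonneg μ _) (abs_nonneg _)
    _ ≤ |K₂| * (D * (K₁ * ∫ t, ‖bump φ 1 a t‖ ∂μ)) :=
        mul_le_mul_of_nonneg_left (mul_le_mul (hν r) (hK₁ _) (R.sigma_nonneg μ _) hD)
          (abs_nonneg _)
    _ = |K₂| * (D * K₁) * ‖a‖ := by rw [integral_norm_bump μ hφ]; ring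

theorem integrable_integral_norm_convKernel (f g : C_c(G, A)) :
    Integrable (fun s => ∫ r, ‖convKernel S f g s r‖ ∂μ) μ := by
  refine Continuous.integrable_of_hasCompactSupport ?_ <| HasCompactSupport.intro
    (f.hasCompactSupport.isCompact.mul g.hasCompactSupport.isCompact) fun s hs => ?_
  · rw [← continuousOn_univ]
    exact continuousOn_integral_of_compact_support (f := fun s r => ‖convKernel S f g s r‖)
      f.hasCompactSupport (continuous_convKernel S f g).norm.continuousOn
      fun s r _ hr => norm_eq_zero.2 (convKernel_eq_zero S f g fun h => hr h.1)
  · simp only [fun r => convKernel_eq_zero S f g fun h : (r, s) ∈ _ => hs h.2, norm_zero,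
      integral_zero]

theorem integral_norm_twistedConv_le (f g : C_c(G, A)) :
    ∫ s, ‖twistedConv S μ f g s‖ ∂μ ≤ ∫ s, ∫ r, ‖convKernel S f g s r‖ ∂μ ∂μ :=
  integral_mono (integrable_norm_cc μ _) (integrable_integral_norm_convKernel μ f g)
    fun _ => norm_integral_le_integral_norm _

theorem integral_integral_norm_convKernel_le {K : ℝ} (hK : ∀ r a, ‖S.act r a‖ ≤ K * ‖a‖)
    (f g : C_c(G, A)) :
    ∫ s, ∫ r, ‖convKernel S f g s r‖ ∂μ ∂μ ≤ K * ((∫ r, ‖f r‖ ∂μ) * ∫ s, ‖g s‖ ∂μ) := by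
  calc ∫ s, ∫ r, ‖convKernel S f g s r‖ ∂μ ∂μ = ∫ r, ∫ s, ‖convKernel S f g s r‖ ∂μ ∂μ :=
        (integral_integral_swap_of_hasCompactSupport (f := fun r s => ‖convKernel S f g s r‖)
          ((continuous_convKernel S f g).norm.comp continuous_swap)
          (hasCompactSupport_convKernel_swap S f g).norm).symm
    _ = ∫ r, ∫ s, ‖f r * S.act r (g s)‖ ∂μ ∂μ := integral_congr_ae (.of_forall fun r =>
        integral_mul_left_eq_self (fun s => ‖f r * S.act r (g s)‖) r⁻¹)
    _ ≤ ∫ r, ‖f r‖ * (K * ∫ s, ‖g s‖ ∂μ) ∂μ := by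
        refine integral_mono_of_nonneg
          (.of_forall fun r => integral_nonneg fun _ => norm_nonneg _)
          ((integrable_norm_cc μ f).mul_const _) (.of_forall fun r => ?_)
        simp only [← integral_const_mul]
        refine integral_mono_of_nonneg (.of_forall fun s => norm_nonneg _)
          (((integrable_norm_cc μ g).const_mul _).const_mul _) (.of_forall fun s => ?_)
        exact (norm_mul_le _ _).trans (mul_le_mul_of_nonneg_left (hK _ _) (norm_nonneg _))
    _ = K * ((∫ r, ‖f r‖ ∂μ) * ∫ s, ‖g s‖ ∂μ) := by rw [integral_mul_const]; ring

section Series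

variable {K : ℝ} (hK : ∀ r a, ‖S.act r a‖ ≤ K * ‖a‖) {F H : Lp A 1 μ} {f h : ℕ → C_c(G, A)}
  (hf : HasSum (fun n => toLOne 𝕜 μ (f n)) F) (hfs : Summable fun n => ∫ t, ‖f n t‖ ∂μ)
  (hh : HasSum (fun n => toLOne 𝕜 μ (h n)) H) (hhs : Summable fun n => ∫ t, ‖h n t‖ ∂μ)

include hK hfs hhs in
theorem summable_integral_integral_norm_convKernel : Summable fun p : ℕ × ℕ =>
    ∫ s, ∫ r, ‖convKernel S (f p.1) (h p.2) s r‖ ∂μ ∂μ :=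
  .of_nonneg_of_le (fun _ => integral_nonneg fun _ => integral_nonneg fun _ => norm_nonneg _)
    (fun p => integral_integral_norm_convKernel_le μ hK (f p.1) (h p.2))
    ((hfs.mul_of_nonneg hhs (fun _ => integral_nonneg fun _ => norm_nonneg _)
      fun _ => integral_nonneg fun _ => norm_nonneg _).mul_left K)

variable [μ.Regular]

include hK hf hfs hh hhs

theorem ae_integrable_and_hasSum_twistedConv :
    ∀ᵐ s ∂μ, Integrable (fun r => F r * S.act r (H (r⁻¹ * s))) μ ∧
      HasSum (fun p : ℕ × ℕ => twistedConv S μ (f p.1) (h p.2) s) (twistedConvFun S μ F H s) := by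
  have hnn : ∀ (p : ℕ × ℕ) s, 0 ≤ ∫ r, ‖convKernel S (f p.1) (h p.2) s r‖ ∂μ := fun p s =>
    integral_nonneg fun _ => norm_nonneg _
  have hae := ae_summable_norm
    (fun p : ℕ × ℕ => integrable_integral_norm_convKernel (S := S) μ (f p.1) (h p.2))
    (by simpa only [Real.norm_of_nonneg (hnn _ _)] using
      summable_integral_integral_norm_convKernel μ hK hfs hhs)
  simp only [Real.norm_of_nonneg (hnn _ _)] at hae
  filter_upwards [hae] with s hs
  have hi := fun p : ℕ × ℕ => integrable_convKernel S μ (f p.1) (h p.2) s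
  have hk := ae_hasSum_convKernel μ hK hf hfs hh hhs s
  exact ⟨integrable_of_ae_hasSum hi hs hk, hasSum_integral_of_ae_hasSum hi hs hk⟩

end Series

theorem hasSum_q_of_hasSum_toLOne {Ψ : Lp A 1 μ →L[𝕜] R.CrossedProduct μ}
    (hΨ : ∀ f, Ψ (toLOne 𝕜 μ f) = R.q μ f) {F : Lp A 1 μ} {f : ℕ → C_c(G, A)}
    (hf : HasSum (fun n => toLOne 𝕜 μ (f n)) F) : HasSum (fun n => R.q μ (f n)) (Ψ F) := by
  simpa only [hΨ] using hf.mapL Ψ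

theorem summable_norm_q (h₁ : ∃ K : ℝ, ∀ f : C_c(G, A), R.sigma μ f ≤ K * ∫ s, ‖f s‖ ∂μ)
    {f : ℕ → C_c(G, A)} (hf : Summable fun n => ∫ t, ‖f n t‖ ∂μ) :
    Summable fun n => ‖R.q μ (f n)‖ := by
  obtain ⟨K, hK⟩ := h₁
  exact .of_nonneg_of_le (fun _ => norm_nonneg _) (fun n => (R.norm_q μ _).trans_le (hK _))
    (hf.mul_left K)

theorem lOneEquiv_symm_mul [μ.Regular] {D : ℝ} (hν : ∀ r, R.nu r ≤ D)
    (h₁ : ∃ K : ℝ, ∀ f : C_c(G, A), R.sigma μ f ≤ K * ∫ s, ‖f s‖ ∂μ)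
    (h₂ : ∃ K : ℝ, ∀ f : C_c(G, A), ∫ s, ‖f s‖ ∂μ ≤ K * R.sigma μ f) (F H : Lp A 1 μ) :
    (∀ᵐ s ∂μ, Integrable (fun r => F r * S.act r (H (r⁻¹ * s))) μ) ∧
      (R.lOneEquiv μ h₁ h₂).symm (R.lOneEquiv μ h₁ h₂ F * R.lOneEquiv μ h₁ h₂ H)
        =ᵐ[μ] twistedConvFun S μ F H := by
  set Ψ := R.lOneEquiv μ h₁ h₂
  have hΨ : ∀ f, (Ψ : Lp A 1 μ →L[𝕜] R.CrossedProduct μ) (toLOne 𝕜 μ f) = R.q μ f :=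
    R.lOneEquiv_toLOne μ h₁ h₂
  obtain ⟨K, hK⟩ := exists_norm_act_le μ hν h₂
  obtain ⟨f, hf, hfs⟩ := exists_hasSum_toLOne 𝕜 μ F
  obtain ⟨h, hh, hhs⟩ := exists_hasSum_toLOne 𝕜 μ H
  have hae := ae_integrable_and_hasSum_twistedConv μ hK hf hfs hh hhs
  refine ⟨hae.mono fun s hs => hs.1, ?_⟩
  have hsum : HasSum (fun p : ℕ × ℕ => toLOne 𝕜 μ (twistedConv S μ (f p.1) (h p.2)))
      (Ψ.symm (Ψ F * Ψ H)) := by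
    have hmul := hasSum_mul_of_summable_norm
      (hasSum_q_of_hasSum_toLOne μ hΨ hf) (summable_norm_q μ h₁ hfs)
      (hasSum_q_of_hasSum_toLOne μ hΨ hh) (summable_norm_q μ h₁ hhs)
    refine (hmul.mapL (Ψ.symm : R.CrossedProduct μ →L[𝕜] Lp A 1 μ)).congr_fun fun p => ?_
    exact (Ψ.symm_apply_eq.2 ((R.q_conv μ _ _).symm.trans (hΨ _).symm)).symm
  have hnorm : Summable fun p : ℕ × ℕ => ∫ s, ‖twistedConv S μ (f p.1) (h p.2) s‖ ∂μ :=
    .of_nonneg_of_le (fun _ => integral_nonneg fun _ => norm_nonneg _)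
      (fun p => integral_norm_twistedConv_le μ (f p.1) (h p.2))
      (summable_integral_integral_norm_convKernel μ hK hfs hhs)
  filter_upwards [ae_hasSum_toLOne 𝕜 μ hsum hnorm, hae] with s hs hs' using hs.unique hs'.2

end TwistedConvLOne

/-! ## Adjoints for an inner product that induces the given norm -/

section InnerProduct

variable {𝕜 X : Type*} [RCLike 𝕜] {hX : NormedAddCommGroup X} {hX' : NormedSpace 𝕜 X}
  {h : InnerProductSpace 𝕜 X} (hh : h.toNormedSpace = hX')

include hh

theorem exists_inner_eq (y : X) : ∃ L : X →L[𝕜] 𝕜, ∀ x, L x = h.inner y x := by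
  subst hh
  exact ⟨innerSL 𝕜 y, fun x => rfl⟩

variable [CompleteSpace X] {T T' : X →L[𝕜] X} (hT : ∀ x y, h.inner (T x) y = h.inner x (T' y))

include hT

theorem norm_eq_of_inner_eq : ‖T'‖ = ‖T‖ := by
  subst hh
  rw [T.eq_adjoint_iff T' |>.2 hT, LinearIsometryEquiv.norm_map]

theorem norm_mul_of_inner_eq : ‖T' * T‖ = ‖T‖ * ‖T‖ := by
  subst hh
  have hT' : T' = T.adjoint := by
    rw [T.eq_adjoint_iff T' |>.2 hT, ContinuousLinearMap.adjoint_adjoint]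
  rw [hT']
  exact T.norm_adjoint_comp_self

end InnerProduct

/-! ## The involution on `C_c(G, A)` and adjoints of integrated forms -/

namespace CovRep

variable {𝕜 : Type u} [RCLike 𝕜] {A : Type*} [NonUnitalNormedRing A] [NormedSpace 𝕜 A]
  [StarRing A] {G : Type*} [Group G] [TopologicalSpace G] [IsTopologicalGroup G]
  {S : DynSystem 𝕜 A G} {X : BanachSpace.{u, v} 𝕜} (ρ : CovRep S X)

theorem hasCompactSupport_U_inv_star (f : C_c(G, A)) (y : X) :
    HasCompactSupport fun s => ρ.U s⁻¹ (ρ.π (star (f s)) y) :=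
  HasCompactSupport.intro f.hasCompactSupport fun s hs => by
    simp [image_eq_zero_of_notMem_tsupport hs]

theorem continuous_U_inv_star [LocallyCompactSpace G] [ContinuousStar A] (f : C_c(G, A)) (y : X) :
    Continuous fun s => ρ.U s⁻¹ (ρ.π (star (f s)) y) :=
  (continuous_uncurry_of_strong ρ.U ρ.continuous_U).comp (continuous_inv.prodMk
    ((ρ.π.continuous.comp (continuous_star.comp f.continuous)).clm_apply continuous_const))

end CovRep

section StarCc

variable {𝕜 : Type u} [RCLike 𝕜] {A : Type*} [NonUnitalNormedRing A] [NormedSpace 𝕜 A]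
  [NormedSpace ℝ A] [IsScalarTower ℝ 𝕜 A] [StarRing A]

theorem star_real_smul (𝕜 : Type*) [RCLike 𝕜] [NormedSpace 𝕜 A] [IsScalarTower ℝ 𝕜 A]
    [StarModule 𝕜 A] (r : ℝ) (a : A) : star (r • a) = r • star a := by
  rw [← algebraMap_smul 𝕜 r a, ← algebraMap_smul 𝕜 r (star a), star_smul]
  exact congrArg (· • star a) (RCLike.conj_ofReal r)

variable [IsScalarTower 𝕜 A A] [SMulCommClass 𝕜 A A] [CompleteSpace A] [ContinuousStar A]
  {G : Type*} [Group G] [TopologicalSpace G] [IsTopologicalGroup G] [LocallyCompactSpace G]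
  [T2Space G] [MeasurableSpace G] [BorelSpace G] {S : DynSystem 𝕜 A G}

theorem starCc_apply (f : C_c(G, A)) (s : G) :
    starCc S f s = modularFun s⁻¹ • S.act s (star (f s⁻¹)) := rfl

theorem starCc_add (f g : C_c(G, A)) : starCc S (f + g) = starCc S f + starCc S g := by
  ext s
  simp [starCc_apply]

theorem starCc_smul [StarModule 𝕜 A] (c : 𝕜) (f : C_c(G, A)) :
    starCc S (c • f) = star c • starCc S f := by
  ext s
  rw [CompactlySupportedContinuousMap.smul_apply, starCc_apply, starCc_apply,
    CompactlySupportedContinuousMap.smul_apply, star_smul, map_smul,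
    ← algebraMap_smul 𝕜 (modularFun s⁻¹), ← algebraMap_smul 𝕜 (modularFun s⁻¹), smul_comm]

namespace CovRep

variable {X : BanachSpace.{u, v} 𝕜}

section

variable (ρ : CovRep S X) (μ : Measure G) [μ.IsHaarMeasure]

theorem integrated_starCc_apply (f : C_c(G, A)) (y : X) :
    ρ.integrated μ (starCc S f) y = ∫ s, ρ.U s⁻¹ (ρ.π (star (f s)) y) ∂μ := by
  rw [← integral_modularFun_inv_smul μ (ρ.continuous_U_inv_star f y)
    (ρ.hasCompactSupport_U_inv_star f y), integrated_apply]
  refine integral_congr_ae (.of_forall fun s => ?_)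
  simp only [starCc_apply, inv_inv]
  rw [← algebraMap_smul 𝕜 (modularFun s⁻¹) (S.act s (star (f s⁻¹))), map_smul, smul_apply,
    algebraMap_smul, covariant_apply]

theorem tendsto_integrated_starCc_bump [StarModule 𝕜 A] (s : G) (a : A) (y : X) :
    Tendsto (fun φ => ρ.integrated μ (starCc S (bump φ s a)) y) (deltaFilter μ)
      (𝓝 (ρ.U s⁻¹ (ρ.π (star a) y))) := by
  have hint : ∀ φ : C_c(G, ℝ), ρ.integrated μ (starCc S (bump φ s a)) y
      = ∫ t, φ t • ρ.U (s * t)⁻¹ (ρ.π (star a) y) ∂μ := fun φ => by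
    rw [integrated_starCc_apply, ← integral_mul_left_eq_self _ s]
    refine integral_congr_ae (.of_forall fun t => ?_)
    simp only [bump_apply, inv_mul_cancel_left]
    rw [star_real_smul 𝕜, ← algebraMap_smul 𝕜 (φ t) (star a), map_smul, smul_apply,
      map_smul, algebraMap_smul]
  simp only [hint]
  simpa only [mul_one] using tendsto_integral_deltaFilter μ
    (h := fun t => ρ.U (s * t)⁻¹ (ρ.π (star a) y)) ((ρ.continuous_U _).comp (by fun_prop))

end

variable {ρ : CovRep S X} (μ : Measure G) [μ.IsHaarMeasure] {h : InnerProductSpace 𝕜 X}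
  (hh : h.toNormedSpace = X.normedSpace)

include hh

theorem inner_integrated
    (hπ : ∀ a x y, h.inner (ρ.π a x) y = h.inner x (ρ.π (star a) y))
    (hU : ∀ s x y, h.inner (ρ.U s x) (ρ.U s y) = h.inner x y) (f : C_c(G, A)) (x y : X) :
    h.inner (ρ.integrated μ f x) y = h.inner x (ρ.integrated μ (starCc S f) y) := by
  obtain ⟨L, hL⟩ := exists_inner_eq hh x
  obtain ⟨L', hL'⟩ := exists_inner_eq hh y
  rw [← hL, integrated_starCc_apply, ← ContinuousLinearMap.integral_comp_comm L
    ((ρ.continuous_U_inv_star f y).integrable_of_hasCompactSupport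
      (ρ.hasCompactSupport_U_inv_star f y)), ← h.conj_inner_symm, ← hL', integrated_apply,
    ← ContinuousLinearMap.integral_comp_comm L' (ρ.integrable μ f x), ← integral_conj]
  refine integral_congr_ae (.of_forall fun s => ?_)
  simp only [hL, hL']
  rw [h.conj_inner_symm, hπ, ← hU s x, ← U_mul_apply, mul_inv_cancel, U_one_apply]

variable [StarModule 𝕜 A]

theorem inner_π_U_of_integrated
    (hf : ∀ f x y, h.inner (ρ.integrated μ f x) y = h.inner x (ρ.integrated μ (starCc S f) y))
    (s : G) (a : A) (x y : X) :
    h.inner (ρ.π a (ρ.U s x)) y = h.inner x (ρ.U s⁻¹ (ρ.π (star a) y)) := by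
  obtain ⟨L, hL⟩ := exists_inner_eq hh x
  obtain ⟨L', hL'⟩ := exists_inner_eq hh y
  rw [← hL, ← h.conj_inner_symm, ← hL']
  refine tendsto_nhds_unique (((RCLike.continuous_conj.comp L'.continuous).tendsto _).comp
    (ρ.tendsto_integrated_bump μ s a x)) (((L.continuous.tendsto _).comp
      (ρ.tendsto_integrated_starCc_bump μ s a y)).congr fun φ => ?_)
  simp only [Function.comp_apply, hL, hL', h.conj_inner_symm, hf]

theorem inner_π_of_integrated
    (hf : ∀ f x y, h.inner (ρ.integrated μ f x) y = h.inner x (ρ.integrated μ (starCc S f) y))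
    (a : A) (x y : X) : h.inner (ρ.π a x) y = h.inner x (ρ.π (star a) y) := by
  simpa only [inv_one, U_one_apply] using inner_π_U_of_integrated μ hh hf 1 a x y

theorem inner_U_of_integrated (hρ : ρ.IsNonDegenerate)
    (hf : ∀ f x y, h.inner (ρ.integrated μ f x) y = h.inner x (ρ.integrated μ (starCc S f) y))
    (s : G) (x y : X) : h.inner (ρ.U s x) (ρ.U s y) = h.inner x y := by
  obtain ⟨L, hL⟩ := exists_inner_eq hh x
  obtain ⟨L', hL'⟩ := exists_inner_eq hh (ρ.U s x)
  have hLL : L' = L.comp (ρ.U s⁻¹) := by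
    refine ContinuousLinearMap.ext_on hρ ?_
    rintro _ ⟨b, z, rfl⟩
    simp only [ContinuousLinearMap.comp_apply, hL, hL']
    rw [← star_star b, ← inner_π_of_integrated μ hh hf, inner_π_U_of_integrated μ hh hf]
  rw [← hL', hLL, ContinuousLinearMap.comp_apply, ← U_mul_apply, inv_mul_cancel, U_one_apply, hL]

end CovRep

namespace CovRep.IsInvolutive

variable {X : BanachSpace.{u, v} 𝕜} {ρ : CovRep S X} (hρ : ρ.IsInvolutive)
  (μ : Measure G) [μ.IsHaarMeasure]

include hρ

theorem norm_integrated_starCc (f : C_c(G, A)) :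
    ‖ρ.integrated μ (starCc S f)‖ = ‖ρ.integrated μ f‖ := by
  obtain ⟨h, hh, hπ, hU⟩ := hρ
  exact norm_eq_of_inner_eq hh (inner_integrated μ hh hπ hU f)

theorem norm_integrated_starCc_conv_self (f : C_c(G, A)) :
    ‖ρ.integrated μ (twistedConv S μ (starCc S f) f)‖
      = ‖ρ.integrated μ f‖ * ‖ρ.integrated μ f‖ := by
  obtain ⟨h, hh, hπ, hU⟩ := hρ
  rw [integrated_conv]
  exact norm_mul_of_inner_eq hh (inner_integrated μ hh hπ hU f)

theorem integrated_starCc_conv (f g : C_c(G, A)) :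
    ρ.integrated μ (starCc S (twistedConv S μ f g))
      = ρ.integrated μ (twistedConv S μ (starCc S g) (starCc S f)) := by
  obtain ⟨h, hh, hπ, hU⟩ := hρ
  have hf := inner_integrated μ hh hπ hU
  refine ContinuousLinearMap.ext fun y => ext_inner_left 𝕜 fun v => ?_
  rw [← hf, integrated_conv, integrated_conv, mul_apply_eq_comp, mul_apply_eq_comp, hf, hf]

theorem integrated_starCc_starCc (f : C_c(G, A)) :
    ρ.integrated μ (starCc S (starCc S f)) = ρ.integrated μ f := by
  obtain ⟨h, hh, hπ, hU⟩ := hρ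
  have hf := inner_integrated μ hh hπ hU
  refine ContinuousLinearMap.ext fun y => ext_inner_left 𝕜 fun v => ?_
  rw [← hf, ← h.conj_inner_symm, ← hf, h.conj_inner_symm]

end CovRep.IsInvolutive

/-! ## The involution on the crossed product -/

namespace UniformlyBoundedClass

variable {R : UniformlyBoundedClass.{u, v} S} {μ : Measure G} [μ.IsHaarMeasure]

variable (hR : ∀ ρ ∈ R.carrier, ρ.2.IsInvolutive)

include hR

theorem sigma_starCc_le (f : C_c(G, A)) : R.sigma μ (starCc S f) ≤ R.sigma μ f :=
  R.sigma_le_of_forall μ fun ρ hρ => ((hR ρ hρ).norm_integrated_starCc μ f).trans_le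
    (R.norm_integrated_le_sigma μ f ⟨ρ, hρ⟩)

theorem sigma_mul_sigma_le (f : C_c(G, A)) :
    R.sigma μ f * R.sigma μ f ≤ R.sigma μ (twistedConv S μ (starCc S f) f) := by
  rw [← sq, ← Real.le_sqrt (R.sigma_nonneg μ f) (R.sigma_nonneg μ _)]
  refine R.sigma_le_of_forall μ fun ρ hρ => Real.le_sqrt_of_sq_le ?_
  rw [sq, ← (hR ρ hρ).norm_integrated_starCc_conv_self]
  exact R.norm_integrated_le_sigma μ _ ⟨ρ, hρ⟩

variable [StarModule 𝕜 A]

variable (μ) in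
/-- The involution of the crossed product of a class of involutive covariant representations: the
continuous extension of `q(f) ↦ q(f^*)`. -/
def starMap : R.CrossedProduct μ →L⋆[𝕜] R.CrossedProduct μ :=
  ContinuousLinearMap.extend (LinearMap.mkContinuous (E := CcAlgebra μ R)
    { toFun f := R.q μ (starCc S f)
      map_add' f g := (congrArg (R.q μ) (starCc_add f g)).trans (map_add (R.qₗ μ) _ _)
      map_smul' c f := (congrArg (R.q μ) (starCc_smul c f)).trans
        (map_smul (R.qₗ μ) (star c) _) } 1
    fun f => by
      rw [one_mul]
      exact (norm_q R μ (starCc S f)).trans_le (sigma_starCc_le hR f))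
    (CrossedProduct.incl R μ)

theorem starMap_q (f : C_c(G, A)) : starMap μ hR (R.q μ f) = R.q μ (starCc S f) :=
  ContinuousLinearMap.extend_eq _ (CrossedProduct.denseRange_incl R μ)
    (CrossedProduct.isUniformInducing_incl R μ) (toCc R μ f)

theorem starMap_starMap (c : R.CrossedProduct μ) : starMap μ hR (starMap μ hR c) = c := by
  refine induction_q c (isClosed_eq (by fun_prop) continuous_id) fun f => ?_
  rw [starMap_q, starMap_q]
  exact q_eq_q fun ρ hρ => (hR ρ hρ).integrated_starCc_starCc μ f

theorem starMap_mul (c d : R.CrossedProduct μ) :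
    starMap μ hR (c * d) = starMap μ hR d * starMap μ hR c := by
  refine induction_q c (isClosed_eq (by fun_prop) (by fun_prop)) fun f => ?_
  refine induction_q d (isClosed_eq (by fun_prop) (by fun_prop)) fun g => ?_
  rw [← q_conv, starMap_q, starMap_q, starMap_q, ← q_conv]
  exact q_eq_q fun ρ hρ => (hR ρ hρ).integrated_starCc_conv μ f g

theorem norm_mul_self_le_norm_starMap_mul (c : R.CrossedProduct μ) :
    ‖c‖ * ‖c‖ ≤ ‖starMap μ hR c * c‖ := by
  refine induction_q c (isClosed_le (by fun_prop) (by fun_prop)) fun f => ?_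
  rw [starMap_q, ← q_conv, norm_q, norm_q]
  exact sigma_mul_sigma_le hR f

theorem exists_cstarRing :
    ∃ (_ : StarRing (R.CrossedProduct μ)) (_ : StarModule 𝕜 (R.CrossedProduct μ))
      (_ : CStarRing (R.CrossedProduct μ)), ∀ f, star (R.q μ f) = R.q μ (starCc S f) :=
  let _ : StarRing (R.CrossedProduct μ) :=
    { star := starMap μ hR
      star_involutive := starMap_starMap hR
      star_mul := starMap_mul hR
      star_add := map_add (starMap μ hR) }
  ⟨inferInstance, ⟨map_smulₛₗ (starMap μ hR)⟩,
    ⟨fun {c} => norm_mul_self_le_norm_starMap_mul hR c⟩, starMap_q hR⟩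

end UniformlyBoundedClass

variable {R : UniformlyBoundedClass.{u, v} S} {μ : Measure G} [μ.IsHaarMeasure]
  [StarRing (R.CrossedProduct μ)] (hstar : ∀ f, star (R.q μ f) = R.q μ (starCc S f))
  {X : BanachSpace.{u, w} 𝕜} {ρ : CovRep S X} (h : ρ.IsRContinuous μ R)

include hstar

theorem CovRep.IsInvolutive.integration [ContinuousStar (R.CrossedProduct μ)]
    (hρ : ρ.IsInvolutive) : (ρ.integration h).IsInvolutive := by
  obtain ⟨i, hi, hπ, hU⟩ := hρ
  refine ⟨i, hi, fun c x y => ?_⟩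
  obtain ⟨L, hL⟩ := exists_inner_eq hi x
  obtain ⟨L', hL'⟩ := exists_inner_eq hi y
  rw [← hL, ← i.conj_inner_symm, ← hL']
  refine UniformlyBoundedClass.induction_q c (isClosed_eq
    (RCLike.continuous_conj.comp (by fun_prop))
    (L.continuous.comp (((ρ.integration h).T.continuous.comp continuous_star).clm_apply
      continuous_const))) fun f => ?_
  rw [hstar, integration_q, integration_q, hL, hL', i.conj_inner_symm]
  exact inner_integrated μ hi hπ hU f x y

variable [StarModule 𝕜 A]

theorem CovRep.isInvolutive_of_integration (hρ : ρ.IsNonDegenerate)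
    (hT : (ρ.integration h).IsInvolutive) : ρ.IsInvolutive := by
  obtain ⟨i, hi, hT⟩ := hT
  have hf : ∀ f x y, i.inner (ρ.integrated μ f x) y
      = i.inner x (ρ.integrated μ (starCc S f) y) := fun f x y => by
    rw [← ρ.integration_q h, ← ρ.integration_q h, ← hstar]
    exact hT (R.q μ f) x y
  exact ⟨i, hi, inner_π_of_integrated μ hi hf, inner_U_of_integrated μ hi hρ hf⟩

theorem CovRep.isInvolutive_iff [ContinuousStar (R.CrossedProduct μ)] (hρ : ρ.IsNonDegenerate) :
    ρ.IsInvolutive ↔ (ρ.integration h).IsInvolutive :=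
  ⟨IsInvolutive.integration hstar h, isInvolutive_of_integration hstar h hρ⟩

end StarCc

end

end CrossedProd

section

universe u v w

theorem theoremt_general {𝕜 : Type u} [RCLike 𝕜]
    {A : Type*} [NonUnitalNormedRing A] [NormedSpace 𝕜 A] [IsScalarTower 𝕜 A A]
    [SMulCommClass 𝕜 A A] [CompleteSpace A] [NormedSpace ℝ A] [IsScalarTower ℝ 𝕜 A]
    {G : Type*} [Group G] [TopologicalSpace G] [IsTopologicalGroup G] [LocallyCompactSpace G]
    [T2Space G] [MeasurableSpace G] [BorelSpace G]
    (μ : Measure G) [μ.IsHaarMeasure] [μ.Regular]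
    (S : CrossedProd.DynSystem 𝕜 A G) (hA : CrossedProd.HasBoundedApproxLeftIdentity A)
    (R : CrossedProd.UniformlyBoundedClass.{u, v} S) {D : ℝ} (hν : ∀ r, R.nu r ≤ D)
    {C₁ : ℝ} (hL : ∀ f : C_c(G, A), ∫ s, ‖f s‖ ∂μ ≤ C₁ * R.sigma μ f)
    (𝒳 : Set (CrossedProd.BanachSpace.{u, w} 𝕜)) :
    (∀ (X : CrossedProd.BanachSpace.{u, w} 𝕜) (ρ : CrossedProd.CovRep S X),
      ρ.IsUniformlyBounded → ρ.IsRContinuous μ R) ∧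
    Set.BijOn (CrossedProd.integrationMap μ R)
      {p | p.1 ∈ 𝒳 ∧ p.2.1.IsNonDegenerate ∧ p.2.1.IsUniformlyBounded}
      {t | t.1 ∈ 𝒳 ∧ t.2.IsNonDegenerate} ∧
    (∀ (X : CrossedProd.BanachSpace.{u, w} 𝕜) (ρ : CrossedProd.CovRep S X)
      (h : ρ.IsRContinuous μ R), ρ.IsNonDegenerate → ∀ Y : Submodule 𝕜 X, IsClosed (Y : Set X) →
        (ρ.IsInvariant Y ↔ (ρ.integration h).IsInvariant Y)) ∧
    (∀ (X X' : CrossedProd.BanachSpace.{u, w} 𝕜) (ρ : CrossedProd.CovRep S X)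
      (ρ' : CrossedProd.CovRep S X') (h : ρ.IsRContinuous μ R) (h' : ρ'.IsRContinuous μ R),
      ρ.IsNonDegenerate → ρ'.IsNonDegenerate → ∀ Φ : X →L[𝕜] X',
        (ρ.Intertwines ρ' Φ ↔ (ρ.integration h).Intertwines (ρ'.integration h') Φ)) ∧
    (∃ Ψ : Lp A 1 μ ≃L[𝕜] R.CrossedProduct μ,
      (∀ f : C_c(G, A),
        Ψ ((f.continuous.memLp_of_hasCompactSupport f.hasCompactSupport).toLp f) = R.q μ f) ∧
      ∀ F H : Lp A 1 μ,
        (∀ᵐ s ∂μ, Integrable (fun r => F r * S.act r (H (r⁻¹ * s))) μ) ∧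
        Ψ.symm (Ψ F * Ψ H) =ᵐ[μ] CrossedProd.twistedConvFun S μ F H) ∧
    (∀ [StarRing A] [StarModule 𝕜 A] [ContinuousStar A],
      (∀ p ∈ R.carrier, p.2.IsInvolutive) →
      ∃ (_ : StarRing (R.CrossedProduct μ)) (_ : StarModule 𝕜 (R.CrossedProduct μ))
        (_ : CStarRing (R.CrossedProduct μ)),
        (∀ f : C_c(G, A), star (R.q μ f) = R.q μ (CrossedProd.starCc S f)) ∧
        ∀ (X : CrossedProd.BanachSpace.{u, w} 𝕜) (ρ : CrossedProd.CovRep S X)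
          (h : ρ.IsRContinuous μ R), ρ.IsNonDegenerate →
          (ρ.IsInvolutive ↔ (ρ.integration h).IsInvolutive)) := by
  have h₁ := R.exists_sigma_le μ hν
  have h₂ : ∃ K : ℝ, ∀ f : C_c(G, A), ∫ s, ‖f s‖ ∂μ ≤ K * R.sigma μ f := ⟨C₁, hL⟩
  refine ⟨fun _ _ => CrossedProd.CovRep.isRContinuous h₂,
    CrossedProd.bijOn_integrationMap hA hν h₂ 𝒳,
    fun _ ρ h hρ _ hY => ρ.isInvariant_iff hA hρ h hY,
    fun _ _ ρ _ h h' hρ hρ' Φ => ρ.intertwines_iff hA hρ hρ' h h' Φ,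
    ⟨R.lOneEquiv μ h₁ h₂, R.lOneEquiv_toLOne μ h₁ h₂,
      CrossedProd.lOneEquiv_symm_mul μ hν h₁ h₂⟩, ?_⟩
  intro _ _ _ hinv
  obtain ⟨i₁, i₂, i₃, hstar⟩ := CrossedProd.UniformlyBoundedClass.exists_cstarRing (μ := μ) hinv
  exact ⟨i₁, i₂, i₃, hstar, fun _ _ h hρ => CrossedProd.CovRep.isInvolutive_iff hstar h hρ⟩

end

theorem theoremt {𝕜 : Type*} [RCLike 𝕜]
    {A : Type*} [NonUnitalNormedRing A] [NormedSpace 𝕜 A] [IsScalarTower 𝕜 A A]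
    [SMulCommClass 𝕜 A A] [CompleteSpace A] [NormedSpace ℝ A] [IsScalarTower ℝ 𝕜 A]
    {G : Type*} [Group G] [TopologicalSpace G] [IsTopologicalGroup G] [LocallyCompactSpace G]
    [T2Space G] [MeasurableSpace G] [BorelSpace G]
    (μ : Measure G) [μ.IsHaarMeasure] [μ.Regular]
    (S : CrossedProd.DynSystem 𝕜 A G) (hA : CrossedProd.HasBoundedApproxLeftIdentity A)
    (R : CrossedProd.UniformlyBoundedClass S)
    (hR : ∀ p ∈ R.carrier, p.2.IsNonDegenerate)
    (D : ℝ) (hD : 0 ≤ D) (hν : ∀ r, R.nu r ≤ D)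
    (C₁ : ℝ) (hC₁ : 0 ≤ C₁) (hL : ∀ f : C_c(G, A), ∫ s, ‖f s‖ ∂μ ≤ C₁ * R.sigma μ f)
    (𝒳 : Set (CrossedProd.BanachSpace 𝕜)) :
    -- the covariant representations in question are `𝓡`-continuous, so that `(π ⋊ U)^𝓡` is defined
    (∀ X ∈ 𝒳, ∀ ρ : CrossedProd.CovRep S X,
      ρ.IsNonDegenerate → ρ.IsUniformlyBounded → ρ.IsRContinuous μ R) ∧
    -- the bijection
    Set.BijOn (CrossedProd.integrationMap μ R)
      {p | p.1 ∈ 𝒳 ∧ p.2.1.IsNonDegenerate ∧ p.2.1.IsUniformlyBounded}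
      {t | t.1 ∈ 𝒳 ∧ t.2.IsNonDegenerate} ∧
    -- closed invariant subspaces
    (∀ X ∈ 𝒳, ∀ (ρ : CrossedProd.CovRep S X) (h : ρ.IsRContinuous μ R),
      ρ.IsNonDegenerate → ρ.IsUniformlyBounded →
      ∀ Y : Submodule 𝕜 X, IsClosed (Y : Set X) →
        (ρ.IsInvariant Y ↔ (ρ.integration h).IsInvariant Y)) ∧
    -- bounded intertwining operators
    (∀ X ∈ 𝒳, ∀ X' ∈ 𝒳, ∀ (ρ : CrossedProd.CovRep S X) (ρ' : CrossedProd.CovRep S X')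
      (h : ρ.IsRContinuous μ R) (h' : ρ'.IsRContinuous μ R),
      ρ.IsNonDegenerate → ρ.IsUniformlyBounded → ρ'.IsNonDegenerate → ρ'.IsUniformlyBounded →
      ∀ Φ : X →L[𝕜] X',
        (ρ.Intertwines ρ' Φ ↔ (ρ.integration h).Intertwines (ρ'.integration h') Φ)) ∧
    -- the crossed product is isomorphic to `L¹(G, A)` with twisted convolution
    (∃ Ψ : Lp A 1 μ ≃L[𝕜] R.CrossedProduct μ,
      (∀ f : C_c(G, A),
        Ψ ((f.continuous.memLp_of_hasCompactSupport f.hasCompactSupport).toLp f) = R.q μ f) ∧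
      ∀ F H : Lp A 1 μ,
        (∀ᵐ s ∂μ, Integrable (fun r => F r * S.act r (H (r⁻¹ * s))) μ) ∧
        Ψ.symm (Ψ F * Ψ H) =ᵐ[μ] CrossedProd.twistedConvFun S μ F H) ∧
    -- the involutive case: the crossed product is a `C*`-algebra with `q(f)* = q(f*)`, and the
    -- bijection preserves the property of being involutive
    (∀ [StarRing A] [StarModule 𝕜 A] [ContinuousStar A],
      (∀ s a, S.act s (star a) = star (S.act s a)) →
      (∀ p ∈ R.carrier, p.2.IsInvolutive) →
      ∃ (_ : StarRing (R.CrossedProduct μ)) (_ : StarModule 𝕜 (R.CrossedProduct μ))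
        (_ : CStarRing (R.CrossedProduct μ)),
        (∀ f : C_c(G, A), star (R.q μ f) = R.q μ (CrossedProd.starCc S f)) ∧
        ∀ X ∈ 𝒳, ∀ (ρ : CrossedProd.CovRep S X) (h : ρ.IsRContinuous μ R),
          ρ.IsNonDegenerate → ρ.IsUniformlyBounded →
          (ρ.IsInvolutive ↔ (ρ.integration h).IsInvolutive)) := by
  obtain ⟨hcont, hbij, hinv, hint, hLone, hstar⟩ := theoremt_general μ S hA R hν hL 𝒳
  refine ⟨fun X _ ρ _ => hcont X ρ, hbij, fun X _ ρ h hρ _ => hinv X ρ h hρ,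
    fun X _ X' _ ρ ρ' h h' hρ _ hρ' _ => hint X X' ρ ρ' h h' hρ hρ', hLone, fun _ hR => ?_⟩
  obtain ⟨i₁, i₂, i₃, hq, hiff⟩ := hstar hR
  exact ⟨i₁, i₂, i₃, hq, fun X _ ρ h hρ _ => hiff X ρ h hρ⟩
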